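/- Let $k\ge 1$ be an integer, $\lambda_1>k-1$ a rational number and $p_1,\dots,p_{k-1}\ge 0$ integers; put $\lambda_{j+1}=\lambda_j+p_j-1$ for $1\le j\le k-1$. *The algebra.* For a commutative $\mathbb C$-algebra $R$ let $\tilde{\mathcal A}_R$ be the $b$-completion of $R\langle a,b\rangle/(ab-ba-b^2)$; its elements are the series $\sum_{n\ge 0}b^nP_n(a)$ with $P_n\in R[a]$, and it contains $R[[b]]$. Put $\tilde{\mathcal A}=\tilde{\mathcal A}_{\mathbb C}$. *The parameter space.* For $1\le j\le k-1$ let $V_j\subset\mathbb C[[b]]$ be spanned by $1,b,\dots,b^{k-j-1}$ and, if $p_j+\dots+p_{k-1}\ge k-j$, also by $b^{q_j}$, where $q_j=p_j+\dots+p_{j+h}$ with $h\ge 0$ minimal such that $q_j\ge k-j$. Let $\mathcal S=\mathcal S(\lambda_1,p_1,\dots,p_{k-1})$ be the set of $\sigma=(S_1,\dots,S_{k-1})$ with $S_j\in V_j$, $S_j(0)=1$, and the coefficient of $b^{p_j}$ in $S_j$ nonzero, for all $j$. The coefficients of the $S_j$ other than the constant ones identify $\mathcal S$ with an open subset of an affine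 space, hence with a complex manifold. For $\sigma\in\mathcal S$ put $$P(\sigma)=(a-\lambda_1b)S_1^{-1}(a-\lambda_2b)S_2^{-1}\cdots S_{k-1}^{-1}(a-\lambda_kb),\qquad E(\sigma)=\tilde{\mathcal A}/\tilde{\mathcal A}\,P(\sigma),$$ and let $\mathbb E$ be the presheaf $V\mapsto\tilde{\mathcal A}_{\mathcal O(V)}/\tilde{\mathcal A}_{\mathcal O(V)}P$ on $\mathcal S$, where $P$ is the operator above with the tautological series $S_j\in\mathcal O(V)[[b]]$. *Holomorphic families of themes.* On a complex manifold $X$, a sheaf of $\mathcal O_X$-$(a,b)$-modules is a locally free sheaf of finite type of $\mathcal O_X[[b]]$-modules with an $\mathcal O_X$-linear, $b$-adically continuous sheaf endomorphism $a$ such that $ab-ba=b^2$. For a finite set $\Lambda\subset\,]0,1]\cap\mathbb Q$ and $N\ge 0$ let $\Xi_{X,\Lambda}^{(N)}=\bigoplus_{\lambda\in\Lambda}\bigoplus_{j=0}^N\mathcal O_X[[b]]\,e_{\lambda,j}$ with $a\,e_{\lambda,0}=\lambda b\,e_{\lambda,0}$ and $a\,e_{\lambda,j}=\lambda b\,e_{\lambda,j}+b\,e_{\lambda,j-1}$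 for $j\ge1$; let $\Xi_\Lambda^{(N)}$ be the same module over $\mathbb C[[b]]$. A holomorphic map $\varphi:U\to\Xi_\Lambda^{(N)}$ on an open set $U$ (that is, a section over $U$ of $\Xi_{X,\Lambda}^{(N)}$) is $k$-thematic if the subsheaf $\mathbb E_\varphi$ of $\mathcal O_U[[b]]$-modules generated by the $a^\nu\varphi$, $\nu\ge 0$, is free with basis $\varphi,a\varphi,\dots,a^{k-1}\varphi$, and for each $x\in U$ the values $\varphi(x),\dots,a^{k-1}\varphi(x)$ are linearly independent over $\mathbb C[[b]]$ (so that the fibre of $\mathbb E_\varphi$ at $x$ is the rank $k$ theme $\tilde{\mathcal A}\varphi(x)\subset\Xi_\Lambda^{(N)}$). A sheaf of $\mathcal O_X$-$(a,b)$-modules is a holomorphic family of rank $k$ themes if $X$ is covered by open sets $U$ on each of which it is isomorphic to $\mathbb E_\varphi$ for some finite $\Lambda\subset\,]0,1]\cap\mathbb Q$ and some $k$-thematic holomorphic map $\varphi:U\to\Xi_\Lambda^{(k-1)}$. **Theorem.** The canonical family is holomorphic. Precisely: 1. up to a permutation of the coordinates, $\mathcal S=\mathbb C^m\times(\mathbb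 C^*)^n$ for some $m,n\ge 0$; 2. $\mathbb E$ is a sheaf of $\mathcal O_{\mathcal S}$-$(a,b)$-modules; 3. for each $\sigma\in\mathcal S$, the fibre $\mathbb E/\mathcal M_\sigma[[b]]\,\mathbb E$ of $\mathbb E$ at $\sigma$ is $E(\sigma)$ (where $\mathcal M_\sigma$ is the ideal of holomorphic functions vanishing at $\sigma$, and $\mathcal M_\sigma[[b]]$ consists of the series with coefficients in $\mathcal M_\sigma$), and $E(\sigma)$ is a $[\lambda_1]$-primitive theme of rank $k$: it is free of rank $k$ over $\mathbb C[[b]]$, generated by one element, and embeds, compatibly with $a$ and $b$, in some $\Xi_{\{\lambda\}}^{(N)}$ with $\lambda\in\,]0,1]$, $\lambda\equiv\lambda_1 \bmod \mathbb Z$; 4. $\mathbb E$ is a holomorphic family of rank $k$ themes. -/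

import Mathlib

open scoped Manifold ContDiff PowerSeries

namespace ABTheme

/-! ### The algebra `Ã` over a commutative ring -/

/-- The `b`-completion `Ã_R` of the `R`-algebra `R⟨a, b⟩ / (a b - b a - b²)`. Its elements are the
series `∑ b ^ n P_n(a)` with arbitrary polynomials `P_n ∈ R[a]`; the series is stored as the power
series in `b` with coefficients `P_n`, the powers of `b` standing on the left. -/
@[ext]
structure ATilde (R : Type*) [CommRing R] where
  /-- the power series in `b` with coefficients in `R[a]` -/
  series : PowerSeries (Polynomial R)

/-- Left multiplication by `a`: since `a b ^ n = b ^ n a + n b ^ (n + 1)`, it is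
"multiply the coefficients by `a`" plus `b² d/db`. -/
noncomputable def leftA (R : Type*) [CommRing R] :
    Module.End R (PowerSeries (Polynomial R)) where
  toFun u := PowerSeries.C (Polynomial.X : Polynomial R) * u +
    PowerSeries.X ^ 2 * PowerSeries.derivative (Polynomial R) u
  map_add' u v := by rw [map_add]; ring
  map_smul' r u := by
    have h : ∀ w : PowerSeries (Polynomial R), r • w = PowerSeries.C (Polynomial.C r) * w := by
      intro w
      ext n : 1
      rw [PowerSeries.coeff_C_mul, ← Polynomial.smul_eq_C_mul]
      rfl
    simp only [h, Derivation.leibniz, RingHom.id_apply, PowerSeries.derivative_C, smul_eq_mul]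
    ring

theorem coeff_leftA_zero {R : Type*} [CommRing R] (u : PowerSeries (Polynomial R)) :
    PowerSeries.coeff 0 (leftA R u) = Polynomial.X * PowerSeries.coeff 0 u := by
  simp [leftA, pow_two, mul_assoc]

theorem coeff_leftA_succ {R : Type*} [CommRing R] (u : PowerSeries (Polynomial R)) (n : ℕ) :
    PowerSeries.coeff (n + 1) (leftA R u) =
      Polynomial.X * PowerSeries.coeff (n + 1) u + (n : Polynomial R) * PowerSeries.coeff n u := by
  simp only [leftA, LinearMap.coe_mk, AddHom.coe_mk, map_add, PowerSeries.coeff_C_mul, pow_two,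
    mul_assoc, PowerSeries.coeff_succ_X_mul]
  cases n with
  | zero => simp
  | succ m => rw [PowerSeries.coeff_succ_X_mul, PowerSeries.coeff_derivative]; push_cast; ring

/-- The product of `Ã_R`: `(∑ b ^ i P_i(a)) * v = ∑ b ^ i P_i(a) v`, where `P_i(a) v` is computed
with left multiplication by `a`. -/
noncomputable def mulSeries {R : Type*} [CommRing R] (u v : PowerSeries (Polynomial R)) :
    PowerSeries (Polynomial R) :=
  PowerSeries.mk fun n => ∑ ij ∈ Finset.HasAntidiagonal.antidiagonal n,
    PowerSeries.coeff ij.2 (Polynomial.aeval (leftA R) (PowerSeries.coeff ij.1 u) v)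

theorem coeff_mulSeries {R : Type*} [CommRing R] (u v : PowerSeries (Polynomial R)) (n : ℕ) :
    PowerSeries.coeff n (mulSeries u v) = ∑ ij ∈ Finset.HasAntidiagonal.antidiagonal n,
      PowerSeries.coeff ij.2 (Polynomial.aeval (leftA R) (PowerSeries.coeff ij.1 u) v) :=
  PowerSeries.coeff_mk _ _

theorem mulSeries_add {R : Type*} [CommRing R] (u v w : PowerSeries (Polynomial R)) :
    mulSeries u (v + w) = mulSeries u v + mulSeries u w := by
  ext n : 1
  simp [coeff_mulSeries, Finset.sum_add_distrib]

theorem add_mulSeries {R : Type*} [CommRing R] (u v w : PowerSeries (Polynomial R)) :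
    mulSeries (u + v) w = mulSeries u w + mulSeries v w := by
  ext n : 1
  simp [coeff_mulSeries, Finset.sum_add_distrib]

theorem smul_mulSeries {R : Type*} [CommRing R] (r : R) (u w : PowerSeries (Polynomial R)) :
    mulSeries (r • u) w = r • mulSeries u w := by
  ext n : 1
  simp only [coeff_mulSeries, PowerSeries.coeff_smul, map_smul, LinearMap.smul_apply,
    Finset.smul_sum]

theorem leftA_mulSeries {R : Type*} [CommRing R] (u w : PowerSeries (Polynomial R)) :
    mulSeries (leftA R u) w = leftA R (mulSeries u w) := by
  ext n : 1
  cases n with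
  | zero => simp [coeff_mulSeries, coeff_leftA_zero]
  | succ n =>
    rw [coeff_leftA_succ, coeff_mulSeries, coeff_mulSeries, coeff_mulSeries]
    have h1 : ∀ ij : ℕ × ℕ,
        PowerSeries.coeff ij.2 (Polynomial.aeval (leftA R) (PowerSeries.coeff ij.1 (leftA R u)) w)
        = PowerSeries.coeff ij.2 (leftA R (Polynomial.aeval (leftA R) (PowerSeries.coeff ij.1 u) w))
        + (match ij.1 with
          | 0 => 0
          | i + 1 => (i : Polynomial R) * PowerSeries.coeff ij.2
              (Polynomial.aeval (leftA R) (PowerSeries.coeff i u) w)) := by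
      rintro ⟨i, j⟩
      cases i with
      | zero => simp [coeff_leftA_zero]
      | succ i =>
        have h3 : ∀ y : PowerSeries (Polynomial R), PowerSeries.coeff j ((i : PowerSeries
            (Polynomial R)) * y) = (i : Polynomial R) * PowerSeries.coeff j y := by
          intro y
          rw [← nsmul_eq_mul, ← nsmul_eq_mul, map_nsmul]
        simp [coeff_leftA_succ, h3]
    have h2 : ∀ ij : ℕ × ℕ,
        PowerSeries.coeff ij.2 (leftA R (Polynomial.aeval (leftA R) (PowerSeries.coeff ij.1 u) w))
        = Polynomial.X * PowerSeries.coeff ij.2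
            (Polynomial.aeval (leftA R) (PowerSeries.coeff ij.1 u) w)
        + (match ij.2 with
          | 0 => 0
          | j + 1 => (j : Polynomial R) * PowerSeries.coeff j
              (Polynomial.aeval (leftA R) (PowerSeries.coeff ij.1 u) w)) := by
      rintro ⟨i, j⟩
      cases j with
      | zero => simp [coeff_leftA_zero]
      | succ j => rw [coeff_leftA_succ]
    rw [Finset.sum_congr rfl fun ij _ => h1 ij, Finset.sum_add_distrib,
      Finset.sum_congr rfl fun ij _ => h2 ij, Finset.sum_add_distrib, ← Finset.mul_sum, add_assoc]
    congr 1
    rw [Finset.Nat.sum_antidiagonal_succ', Finset.Nat.sum_antidiagonal_succ]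
    simp only [zero_add]
    rw [← Finset.sum_add_distrib, Finset.mul_sum]
    refine Finset.sum_congr rfl fun ij hij => ?_
    rw [Finset.HasAntidiagonal.mem_antidiagonal] at hij
    rw [← hij]
    push_cast
    ring

theorem aeval_mulSeries {R : Type*} [CommRing R] (P : Polynomial R)
    (u w : PowerSeries (Polynomial R)) :
    mulSeries (Polynomial.aeval (leftA R) P u) w =
      Polynomial.aeval (leftA R) P (mulSeries u w) := by
  induction P using Polynomial.induction_on' generalizing u with
  | add p q hp hq => simp [add_mulSeries, hp, hq]
  | monomial n r =>
    have hpow : ∀ m : ℕ, mulSeries ((leftA R ^ m) u) w = (leftA R ^ m) (mulSeries u w) := by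
      intro m
      induction m with
      | zero => simp
      | succ m ih => rw [pow_succ', Module.End.mul_apply, Module.End.mul_apply, leftA_mulSeries, ih]
    simp only [Polynomial.aeval_monomial, Module.End.mul_apply, Module.algebraMap_end_apply,
      smul_mulSeries, hpow]

theorem mulSeries_assoc {R : Type*} [CommRing R] (u v w : PowerSeries (Polynomial R)) :
    mulSeries (mulSeries u v) w = mulSeries u (mulSeries v w) := by
  ext n : 1
  rw [coeff_mulSeries, coeff_mulSeries]
  simp only [← aeval_mulSeries]
  simp only [coeff_mulSeries, map_sum, LinearMap.sum_apply]
  rw [Finset.sum_sigma', Finset.sum_sigma']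
  refine Finset.sum_nbij' (fun x => ⟨(x.2.1, x.2.2 + x.1.2), (x.2.2, x.1.2)⟩)
    (fun x => ⟨(x.1.1 + x.2.1, x.2.2), (x.1.1, x.2.1)⟩) ?_ ?_ ?_ ?_ ?_
  all_goals
    rintro ⟨⟨i, j⟩, ⟨k, l⟩⟩ h
    simp only [Finset.mem_sigma, Finset.HasAntidiagonal.mem_antidiagonal] at h ⊢
  · exact ⟨by omega, trivial⟩
  · exact ⟨by omega, trivial⟩
  · obtain ⟨-, rfl⟩ := h
    rfl
  · obtain ⟨-, rfl⟩ := h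
    rfl

end ABTheme

namespace ABTheme

theorem one_mulSeries {R : Type*} [CommRing R] (u : PowerSeries (Polynomial R)) :
    mulSeries 1 u = u := by
  ext n : 1
  rw [coeff_mulSeries, Finset.sum_eq_single (0, n)]
  · simp
  · rintro ⟨i, j⟩ h1 h2
    have hi : i ≠ 0 := by
      rintro rfl
      rw [Finset.HasAntidiagonal.mem_antidiagonal] at h1
      simp_all
    simp [PowerSeries.coeff_one, hi]
  · intro h
    simp at h

theorem aeval_leftA_C {R : Type*} [CommRing R] (P Q : Polynomial R) :
    Polynomial.aeval (leftA R) P (PowerSeries.C Q) = PowerSeries.C (P * Q) := by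
  induction P using Polynomial.induction_on' with
  | add p q hp hq => simp [add_mul, hp, hq]
  | monomial n r =>
    have hpow : ∀ m : ℕ,
        (leftA R ^ m) (PowerSeries.C Q) = PowerSeries.C (Polynomial.X ^ m * Q) := by
      intro m
      induction m with
      | zero => simp
      | succ m ih =>
        rw [pow_succ', Module.End.mul_apply, ih, pow_succ', mul_assoc]
        simp [leftA]
    rw [Polynomial.aeval_monomial, Module.End.mul_apply, hpow, Module.algebraMap_end_apply,
      ← Polynomial.C_mul_X_pow_eq_monomial, mul_assoc]
    ext m : 1
    rw [PowerSeries.coeff_smul, PowerSeries.coeff_C, PowerSeries.coeff_C]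
    split_ifs
    · rw [Polynomial.smul_eq_C_mul]
    · simp

theorem mulSeries_one {R : Type*} [CommRing R] (u : PowerSeries (Polynomial R)) :
    mulSeries u 1 = u := by
  ext n : 1
  rw [coeff_mulSeries, Finset.sum_eq_single (n, 0)]
  · rw [← map_one PowerSeries.C, aeval_leftA_C]
    simp
  · rintro ⟨i, j⟩ h1 h2
    have hj : j ≠ 0 := by
      rintro rfl
      rw [Finset.HasAntidiagonal.mem_antidiagonal] at h1
      simp_all
    rw [← map_one PowerSeries.C, aeval_leftA_C]
    simp [PowerSeries.coeff_C, hj]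
  · intro h
    simp at h

noncomputable instance (R : Type*) [CommRing R] : Zero (ATilde R) := ⟨⟨0⟩⟩
noncomputable instance (R : Type*) [CommRing R] : One (ATilde R) := ⟨⟨1⟩⟩
noncomputable instance (R : Type*) [CommRing R] : Add (ATilde R) :=
  ⟨fun u v => ⟨u.series + v.series⟩⟩
noncomputable instance (R : Type*) [CommRing R] : Neg (ATilde R) := ⟨fun u => ⟨-u.series⟩⟩
noncomputable instance (R : Type*) [CommRing R] : Mul (ATilde R) :=
  ⟨fun u v => ⟨mulSeries u.series v.series⟩⟩

noncomputable instance (R : Type*) [CommRing R] : Ring (ATilde R) :=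
  Ring.ofMinimalAxioms
    (fun u v w => ATilde.ext (add_assoc u.series v.series w.series))
    (fun u => ATilde.ext (zero_add u.series))
    (fun u => ATilde.ext (neg_add_cancel u.series))
    (fun u v w => ATilde.ext (mulSeries_assoc u.series v.series w.series))
    (fun u => ATilde.ext (one_mulSeries u.series))
    (fun u => ATilde.ext (mulSeries_one u.series))
    (fun u v w => ATilde.ext (mulSeries_add u.series v.series w.series))
    (fun u v w => ATilde.ext (add_mulSeries u.series v.series w.series))

namespace ATilde

theorem series_add {R : Type*} [CommRing R] (u v : ATilde R) :
    (u + v).series = u.series + v.series := rfl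

theorem series_mul {R : Type*} [CommRing R] (u v : ATilde R) :
    (u * v).series = mulSeries u.series v.series := rfl

/-- The generator `a`. -/
noncomputable def a (R : Type*) [CommRing R] : ATilde R := ⟨PowerSeries.C Polynomial.X⟩

/-- The generator `b`. -/
noncomputable def b (R : Type*) [CommRing R] : ATilde R := ⟨PowerSeries.X⟩

/-- Left multiplication by a series `f(b)` is the multiplication of power series in `b`. -/
theorem mulSeries_map_C {R : Type*} [CommRing R] (f : PowerSeries R)
    (u : PowerSeries (Polynomial R)) :
    mulSeries (PowerSeries.map Polynomial.C f) u = PowerSeries.map Polynomial.C f * u := by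
  ext n : 1
  rw [coeff_mulSeries, PowerSeries.coeff_mul]
  refine Finset.sum_congr rfl fun ij _ => ?_
  rw [PowerSeries.coeff_map, Polynomial.aeval_C, Module.algebraMap_end_apply,
    PowerSeries.coeff_smul, Polynomial.smul_eq_C_mul]

/-- The inclusion of the commutative subalgebra `R[[b]]` into `Ã_R`. -/
noncomputable def ofSeries (R : Type*) [CommRing R] : PowerSeries R →+* ATilde R where
  toFun f := ⟨PowerSeries.map Polynomial.C f⟩
  map_one' := ATilde.ext (map_one (PowerSeries.map (Polynomial.C : R →+* Polynomial R)))
  map_zero' := ATilde.ext (map_zero (PowerSeries.map (Polynomial.C : R →+* Polynomial R)))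
  map_add' f g := ATilde.ext (map_add (PowerSeries.map (Polynomial.C : R →+* Polynomial R)) f g)
  map_mul' f g := ATilde.ext <| by rw [series_mul, mulSeries_map_C, map_mul]

theorem series_ofSeries_mul {R : Type*} [CommRing R] (f : PowerSeries R) (u : ATilde R) :
    (ofSeries R f * u).series = PowerSeries.map Polynomial.C f * u.series :=
  mulSeries_map_C f u.series

theorem ofSeries_X {R : Type*} [CommRing R] : ofSeries R PowerSeries.X = b R :=
  ATilde.ext (PowerSeries.map_X (Polynomial.C : R →+* Polynomial R))

theorem series_b_mul {R : Type*} [CommRing R] (u : ATilde R) :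
    (b R * u).series = PowerSeries.X * u.series := by
  rw [← ofSeries_X, series_ofSeries_mul, PowerSeries.map_X]

theorem series_a_mul {R : Type*} [CommRing R] (u : ATilde R) :
    (a R * u).series = leftA R u.series := by
  rw [series_mul]
  ext n : 1
  rw [coeff_mulSeries, Finset.sum_eq_single (0, n)]
  · simp [a]
  · rintro ⟨i, j⟩ h1 h2
    have hi : i ≠ 0 := by
      rintro rfl
      rw [Finset.HasAntidiagonal.mem_antidiagonal] at h1
      simp_all
    simp [a, PowerSeries.coeff_C, hi]
  · intro h
    simp at h

/-- The defining relation `a b - b a = b²`. -/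
theorem a_mul_b_sub {R : Type*} [CommRing R] : a R * b R - b R * a R = b R ^ 2 := by
  rw [sub_eq_iff_eq_add, pow_two]
  refine ATilde.ext ?_
  rw [series_add, series_a_mul, series_b_mul, series_b_mul]
  simp only [leftA, a, b, LinearMap.coe_mk, AddHom.coe_mk, PowerSeries.derivative_X]
  ring

/-- Functoriality of `Ã_R` in `R`: apply a ring homomorphism to all coefficients. -/
noncomputable def map {R R' : Type*} [CommRing R] [CommRing R'] (g : R →+* R') :
    ATilde R →+* ATilde R' where
  toFun u := ⟨PowerSeries.map (Polynomial.mapRingHom g) u.series⟩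
  map_one' := ATilde.ext (map_one (PowerSeries.map (Polynomial.mapRingHom g)))
  map_zero' := ATilde.ext (map_zero (PowerSeries.map (Polynomial.mapRingHom g)))
  map_add' u v :=
    ATilde.ext (map_add (PowerSeries.map (Polynomial.mapRingHom g)) u.series v.series)
  map_mul' u v := by
    have hA : ∀ w : PowerSeries (Polynomial R),
        PowerSeries.map (Polynomial.mapRingHom g) (leftA R w) =
          leftA R' (PowerSeries.map (Polynomial.mapRingHom g) w) := by
      intro w
      ext n : 1
      cases n with
      | zero => rw [PowerSeries.coeff_map, coeff_leftA_zero, coeff_leftA_zero]; simp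
      | succ n => rw [PowerSeries.coeff_map, coeff_leftA_succ, coeff_leftA_succ]; simp
    have hs : ∀ (r : R) (w : PowerSeries (Polynomial R)),
        PowerSeries.map (Polynomial.mapRingHom g) (r • w) =
          g r • PowerSeries.map (Polynomial.mapRingHom g) w := by
      intro r w
      ext n : 1
      rw [PowerSeries.coeff_map, PowerSeries.coeff_smul, PowerSeries.coeff_smul,
        PowerSeries.coeff_map, Polynomial.smul_eq_C_mul, Polynomial.smul_eq_C_mul, map_mul]
      simp
    have hP : ∀ (P : Polynomial R) (w : PowerSeries (Polynomial R)),
        PowerSeries.map (Polynomial.mapRingHom g) (Polynomial.aeval (leftA R) P w) =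
          Polynomial.aeval (leftA R') (Polynomial.mapRingHom g P)
            (PowerSeries.map (Polynomial.mapRingHom g) w) := by
      intro P w
      induction P using Polynomial.induction_on' with
      | add p q hp hq => simp only [map_add, LinearMap.add_apply, hp, hq]
      | monomial n r =>
        have hpow : ∀ m : ℕ, PowerSeries.map (Polynomial.mapRingHom g) ((leftA R ^ m) w) =
            (leftA R' ^ m) (PowerSeries.map (Polynomial.mapRingHom g) w) := by
          intro m
          induction m with
          | zero => simp
          | succ m ih =>
            rw [pow_succ', Module.End.mul_apply, hA, ih, pow_succ', Module.End.mul_apply]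
        rw [Polynomial.coe_mapRingHom, Polynomial.map_monomial, Polynomial.aeval_monomial,
          Polynomial.aeval_monomial, Module.End.mul_apply, Module.End.mul_apply,
          Module.algebraMap_end_apply, Module.algebraMap_end_apply, hs, hpow]
    refine ATilde.ext ?_
    rw [series_mul, series_mul]
    ext n : 1
    rw [PowerSeries.coeff_map, coeff_mulSeries, coeff_mulSeries, map_sum]
    refine Finset.sum_congr rfl fun ij _ => ?_
    rw [← PowerSeries.coeff_map, hP, PowerSeries.coeff_map]

theorem map_a {R R' : Type*} [CommRing R] [CommRing R'] (g : R →+* R') :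
    map g (a R) = a R' :=
  ATilde.ext <| (PowerSeries.map_C (Polynomial.mapRingHom g) Polynomial.X).trans <| by simp [a]

theorem map_ofSeries {R R' : Type*} [CommRing R] [CommRing R'] (g : R →+* R')
    (f : PowerSeries R) : map g (ofSeries R f) = ofSeries R' (PowerSeries.map g f) := by
  refine ATilde.ext (PowerSeries.ext fun n => ?_)
  simp [map, ofSeries]

theorem map_b {R R' : Type*} [CommRing R] [CommRing R'] (g : R →+* R') :
    map g (b R) = b R' := by
  rw [← ofSeries_X, map_ofSeries, PowerSeries.map_X, ofSeries_X]

end ATilde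

end ABTheme

namespace ABTheme

open TopologicalSpace

/-! ### The cyclic left modules `Ã_R / Ã_R P` -/

/-- The left `Ã_R`-module `Ã_R / Ã_R P` (in Mathlib `Ideal` means left ideal). -/
abbrev Cyc (R : Type*) [CommRing R] (P : ATilde R) : Type _ :=
  ATilde R ⧸ (Ideal.span {P} : Ideal (ATilde R))

noncomputable instance (R : Type*) [CommRing R] (P : ATilde R) :
    Module (PowerSeries R) (Cyc R P) :=
  Module.compHom (Cyc R P) (ATilde.ofSeries R)

/-- The action of `a` on `Ã_R / Ã_R P`. -/
noncomputable def Cyc.aAct {R : Type*} [CommRing R] (P : ATilde R) : Cyc R P →+ Cyc R P :=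
  smulAddHom (ATilde R) (Cyc R P) (ATilde.a R)

/-- The map `Ã_R / Ã_R P → Ã_R' / Ã_R' P'` induced by a ring homomorphism that sends `P` to
`P'`. -/
noncomputable def Cyc.map {R R' : Type*} [CommRing R] [CommRing R'] (g : R →+* R')
    {P : ATilde R} {P' : ATilde R'} (h : ATilde.map g P = P') : Cyc R P →+ Cyc R' P' :=
  (Submodule.mapQ (Ideal.span {P} : Ideal (ATilde R)) (Ideal.span {P'} : Ideal (ATilde R'))
    (ATilde.map g).toSemilinearMap (by
      rw [Ideal.span, Submodule.span_le, Set.singleton_subset_iff]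
      change ATilde.map g P ∈ Ideal.span {P'}
      rw [h]
      exact Ideal.subset_span rfl)).toAddMonoidHom

/-- `thetaP lam S n = (a - λ₁ b) S₁⁻¹ (a - λ₂ b) S₂⁻¹ ⋯ Sₙ⁻¹ (a - λₙ₊₁ b)`. Here every `S_j` is a
series with constant term `1`, and `PowerSeries.invOfUnit S_j 1` is its inverse. -/
noncomputable def thetaP {R : Type*} [CommRing R] [Algebra ℂ R] (lam : ℕ → ℚ)
    (S : ℕ → PowerSeries R) : ℕ → ATilde R
  | 0 => ATilde.a R - ATilde.ofSeries R (PowerSeries.C (algebraMap ℂ R (lam 1 : ℂ))) * ATilde.b R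
  | n + 1 => thetaP lam S n * ATilde.ofSeries R (PowerSeries.invOfUnit (S (n + 1)) 1) *
      (ATilde.a R -
        ATilde.ofSeries R (PowerSeries.C (algebraMap ℂ R (lam (n + 2) : ℂ))) * ATilde.b R)

theorem map_invOfUnit {R R' : Type*} [CommRing R] [CommRing R'] (g : R →+* R')
    (f : PowerSeries R) (hf : PowerSeries.constantCoeff f = 1) :
    PowerSeries.map g (PowerSeries.invOfUnit f 1) =
      PowerSeries.invOfUnit (PowerSeries.map g f) 1 := by
  have h1 : f * PowerSeries.invOfUnit f 1 = 1 := PowerSeries.mul_invOfUnit f 1 (by simpa using hf)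
  have h2 : PowerSeries.map g f * PowerSeries.invOfUnit (PowerSeries.map g f) 1 = 1 :=
    PowerSeries.mul_invOfUnit _ 1 (by
      rw [← PowerSeries.coeff_zero_eq_constantCoeff_apply, PowerSeries.coeff_map,
        PowerSeries.coeff_zero_eq_constantCoeff_apply, hf]
      simp)
  have h3 : PowerSeries.map g f * PowerSeries.map g (PowerSeries.invOfUnit f 1) = 1 := by
    rw [← map_mul, h1, map_one]
  exact (left_inv_eq_right_inv ((mul_comm _ _).trans h2) h3).symm

theorem map_thetaP {R R' : Type*} [CommRing R] [CommRing R'] [Algebra ℂ R] [Algebra ℂ R']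
    (g : R →ₐ[ℂ] R') (lam : ℕ → ℚ) (S : ℕ → PowerSeries R)
    (hS : ∀ j, PowerSeries.constantCoeff (S j) = 1) (n : ℕ) :
    ATilde.map (g : R →+* R') (thetaP lam S n) =
      thetaP lam (fun j => PowerSeries.map (g : R →+* R') (S j)) n := by
  induction n with
  | zero =>
    simp only [thetaP, map_sub, map_mul, ATilde.map_a, ATilde.map_b, ATilde.map_ofSeries,
      PowerSeries.map_C, RingHom.coe_coe, AlgHom.commutes]
  | succ n ih =>
    simp only [thetaP, map_sub, map_mul, ATilde.map_a, ATilde.map_b, ATilde.map_ofSeries,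
      PowerSeries.map_C, RingHom.coe_coe, AlgHom.commutes, ih, map_invOfUnit _ _ (hS _)]

/-! ### Holomorphic functions and sheaves of `(a,b)`-modules on a complex manifold -/

/-- The ring `𝒪_X(V)` of holomorphic functions on an open subset `V` of a complex manifold `X`. -/
abbrev Hol (E : Type*) {X : Type*} [NormedAddCommGroup E] [NormedSpace ℂ E] [TopologicalSpace X]
    [ChartedSpace E X] (V : Opens X) : Type _ :=
  C^ω⟮𝓘(ℂ, E), V; 𝓘(ℂ, ℂ), ℂ⟯

/-- The ring `𝒪_X(V)[[b]]`. -/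
abbrev HolB (E : Type*) {X : Type*} [NormedAddCommGroup E] [NormedSpace ℂ E] [TopologicalSpace X]
    [ChartedSpace E X] (V : Opens X) : Type _ :=
  PowerSeries (Hol E V)

/-- Restriction of holomorphic functions. -/
noncomputable def Hol.res (E : Type*) {X : Type*} [NormedAddCommGroup E] [NormedSpace ℂ E]
    [TopologicalSpace X] [ChartedSpace E X] {V W : Opens X} (h : W ≤ V) :
    Hol E V →ₐ[ℂ] Hol E W :=
  { ContMDiffMap.restrictRingHom 𝓘(ℂ, E) 𝓘(ℂ, ℂ) ℂ h with
    commutes' := fun _ => rfl }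

/-- Evaluation of holomorphic functions at a point. -/
noncomputable def Hol.eval (E : Type*) {X : Type*} [NormedAddCommGroup E] [NormedSpace ℂ E]
    [TopologicalSpace X] [ChartedSpace E X] {V : Opens X} (x : V) : Hol E V →ₐ[ℂ] ℂ where
  toFun f := f x
  map_one' := rfl
  map_mul' _ _ := rfl
  map_zero' := rfl
  map_add' _ _ := rfl
  commutes' _ := rfl

/-- Restriction `𝒪_X(V)[[b]] → 𝒪_X(W)[[b]]`, coefficient by coefficient. -/
noncomputable def HolB.res {E X : Type*} [NormedAddCommGroup E] [NormedSpace ℂ E]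
    [TopologicalSpace X] [ChartedSpace E X] {V W : Opens X} (h : W ≤ V) :
    HolB E V →+* HolB E W :=
  PowerSeries.map (Hol.res E h : Hol E V →+* Hol E W)

/-- Evaluation `𝒪_X(V)[[b]] → ℂ[[b]]` at a point, coefficient by coefficient. -/
noncomputable def HolB.eval {E X : Type*} [NormedAddCommGroup E] [NormedSpace ℂ E]
    [TopologicalSpace X] [ChartedSpace E X] {V : Opens X} (x : V) :
    HolB E V →+* PowerSeries ℂ :=
  PowerSeries.map (Hol.eval E x : Hol E V →+* ℂ)

/-- The data of a presheaf of `𝒪_X[[b]]`-modules with an operator `a`. The conditions that make it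
a sheaf of `𝒪_X`-`(a,b)`-modules are stated in `IsABSheaf`. -/
structure ABPresheaf (E X : Type) [NormedAddCommGroup E] [NormedSpace ℂ E] [TopologicalSpace X]
    [ChartedSpace E X] where
  /-- the sections over an open set -/
  obj : Opens X → Type
  [grp : ∀ V, AddCommGroup (obj V)]
  [mod : ∀ V, Module (HolB E V) (obj V)]
  /-- the operator `a` -/
  aMap : ∀ V, obj V →+ obj V
  /-- the restriction maps -/
  res : ∀ {V W : Opens X}, W ≤ V → obj V →+ obj W

attribute [instance] ABPresheaf.grp ABPresheaf.mod

/-- A sheaf of `𝒪_X`-`(a,b)`-modules: a locally free sheaf of finite type of `𝒪_X[[b]]`-modules with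
an `𝒪_X`-linear, `b`-adically continuous sheaf map `a` such that `a b - b a = b²`. -/
structure IsABSheaf {E X : Type} [NormedAddCommGroup E] [NormedSpace ℂ E] [TopologicalSpace X]
    [ChartedSpace E X] (F : ABPresheaf E X) : Prop where
  res_self : ∀ (V : Opens X) (s : F.obj V), F.res le_rfl s = s
  res_res : ∀ {U V W : Opens X} (h : V ≤ U) (h' : W ≤ V) (s : F.obj U),
    F.res h' (F.res h s) = F.res (h'.trans h) s
  res_smul : ∀ {V W : Opens X} (h : W ≤ V) (f : HolB E V) (s : F.obj V),
    F.res h (f • s) = HolB.res h f • F.res h s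
  /-- sections that agree locally are equal -/
  separated : ∀ (V : Opens X) (s t : F.obj V),
    (∀ x ∈ V, ∃ (W : Opens X) (h : W ≤ V), x ∈ W ∧ F.res h s = F.res h t) → s = t
  /-- compatible sections glue -/
  glue : ∀ {I : Type} (U : I → Opens X) (s : ∀ i, F.obj (U i)),
    (∀ i j, F.res (inf_le_left : U i ⊓ U j ≤ U i) (s i) =
      F.res (inf_le_right : U i ⊓ U j ≤ U j) (s j)) →
    ∃ t : F.obj (iSup U), ∀ i, F.res (le_iSup U i) t = s i
  /-- locally, there is a finite basis -/
  locally_free : ∀ x : X, ∃ (U : Opens X) (r : ℕ) (e : Fin r → F.obj U), x ∈ U ∧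
    ∀ (V : Opens X) (h : V ≤ U), LinearIndependent (HolB E V) (fun i => F.res h (e i)) ∧
      Submodule.span (HolB E V) (Set.range fun i => F.res h (e i)) = ⊤
  /-- `a` is a map of sheaves -/
  res_aMap : ∀ {V W : Opens X} (h : W ≤ V) (s : F.obj V),
    F.res h (F.aMap V s) = F.aMap W (F.res h s)
  /-- `a` is `𝒪_X`-linear -/
  aMap_C_smul : ∀ (V : Opens X) (f : Hol E V) (s : F.obj V),
    F.aMap V ((PowerSeries.C f : HolB E V) • s) = (PowerSeries.C f : HolB E V) • F.aMap V s
  /-- `a` is continuous for the `b`-adic topology -/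
  aMap_continuous : ∀ (V : Opens X) (n : ℕ), ∃ m : ℕ, ∀ s : F.obj V, ∃ t : F.obj V,
    F.aMap V ((PowerSeries.X ^ m : HolB E V) • s) = (PowerSeries.X ^ n : HolB E V) • t
  /-- `a b - b a = b²` -/
  aMap_b : ∀ (V : Opens X) (s : F.obj V),
    F.aMap V ((PowerSeries.X : HolB E V) • s) - (PowerSeries.X : HolB E V) • F.aMap V s =
      (PowerSeries.X ^ 2 : HolB E V) • s

/-- The `ℂ[[b]]`-module `M` with the operator `aM` is the fibre `F(x) = F / 𝓜_x[[b]] F` at `x`: there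
is an evaluation map `ev` from the germs of sections of `F` at `x` onto `M`, compatible with
evaluation `𝒪_X[[b]] → ℂ[[b]]` at `x` and with `a`, whose kernel consists of the germs in
`𝓜_x[[b]] F`, where `𝓜_x[[b]]` consists of the series all of whose coefficients vanish at `x`. -/
def IsFibre {E X : Type} [NormedAddCommGroup E] [NormedSpace ℂ E] [TopologicalSpace X]
    [ChartedSpace E X] (F : ABPresheaf E X) (x : X) (M : Type) [AddCommGroup M]
    [Module (PowerSeries ℂ) M] (aM : M →+ M) : Prop :=
  ∃ ev : ∀ V : Opens X, x ∈ V → (F.obj V →+ M),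
    (∀ (V W : Opens X) (h : W ≤ V) (hx : x ∈ W) (s : F.obj V),
      ev W hx (F.res h s) = ev V (h hx) s) ∧
    (∀ (V : Opens X) (hx : x ∈ V) (f : HolB E V) (s : F.obj V),
      ev V hx (f • s) = HolB.eval (⟨x, hx⟩ : V) f • ev V hx s) ∧
    (∀ (V : Opens X) (hx : x ∈ V) (s : F.obj V), ev V hx (F.aMap V s) = aM (ev V hx s)) ∧
    (∀ m : M, ∃ (V : Opens X) (hx : x ∈ V) (s : F.obj V), ev V hx s = m) ∧
    (∀ (V : Opens X) (hx : x ∈ V) (s : F.obj V), ev V hx s = 0 ↔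
      ∃ (W : Opens X) (h : W ≤ V) (hxW : x ∈ W),
        F.res h s ∈ RingHom.ker (HolB.eval (E := E) (⟨x, hxW⟩ : W)) •
          (⊤ : Submodule (HolB E W) (F.obj W)))

/-! ### The modules `Ξ_Λ^{(N)}`, themes and thematic maps -/

/-- `Ξ_Λ^{(N)} = ⊕_{λ ∈ Λ} ⊕_{j ≤ N} R[[b]] e_{λ,j}`; an element is the family of its
coordinates. -/
abbrev Xi (R : Type*) [CommRing R] (Λ : Finset ℚ) (N : ℕ) : Type _ :=
  Λ × Fin (N + 1) → PowerSeries R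

/-- The operator `a` on `Ξ_Λ^{(N)}`, given by `a e_{λ,0} = λ b e_{λ,0}`,
`a e_{λ,j} = λ b e_{λ,j} + b e_{λ,j-1}` for `j ≥ 1`, and `a f(b) = f(b) a + b² f'(b)`. -/
noncomputable def Xi.aMap {R : Type*} [CommRing R] [Algebra ℂ R] {Λ : Finset ℚ} {N : ℕ}
    (v : Xi R Λ N) : Xi R Λ N := fun i =>
  PowerSeries.X ^ 2 * PowerSeries.derivative R (v i) +
    PowerSeries.C (algebraMap ℂ R (((i.1 : ℚ)) : ℂ)) * PowerSeries.X * v i +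
    PowerSeries.X * (if h : (i.2 : ℕ) + 1 < N + 1 then v (i.1, ⟨(i.2 : ℕ) + 1, h⟩) else 0)

/-- Change of coefficients on `Ξ_Λ^{(N)}`. -/
noncomputable def Xi.map {R R' : Type*} [CommRing R] [CommRing R'] {Λ : Finset ℚ} {N : ℕ}
    (g : R →+* R') (v : Xi R Λ N) : Xi R' Λ N := fun i => PowerSeries.map g (v i)

/-- The `R[[b]]`-submodule generated by the `a^ν φ`, `ν ∈ ℕ`. -/
noncomputable def Xi.orbitSpan {R : Type*} [CommRing R] [Algebra ℂ R] {Λ : Finset ℚ} {N : ℕ}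
    (φ : Xi R Λ N) : Submodule (PowerSeries R) (Xi R Λ N) :=
  Submodule.span (PowerSeries R) (Set.range fun ν : ℕ => Xi.aMap^[ν] φ)

theorem Xi.map_aMap {R R' : Type*} [CommRing R] [CommRing R'] [Algebra ℂ R] [Algebra ℂ R']
    {Λ : Finset ℚ} {N : ℕ} (g : R →ₐ[ℂ] R') (v : Xi R Λ N) :
    Xi.map (g : R →+* R') (Xi.aMap v) = Xi.aMap (Xi.map (g : R →+* R') v) := by
  have hd : ∀ f : PowerSeries R, PowerSeries.map (g : R →+* R') (PowerSeries.derivative R f) =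
      PowerSeries.derivative R' (PowerSeries.map (g : R →+* R') f) := by
    intro f
    ext n
    simp [PowerSeries.coeff_derivative]
  funext i
  simp only [Xi.map, Xi.aMap, map_add, map_mul, map_pow, PowerSeries.map_X, PowerSeries.map_C, hd,
    RingHom.coe_coe, AlgHom.commutes]
  split_ifs <;> simp

theorem Xi.map_orbitSpan {R R' : Type*} [CommRing R] [CommRing R'] [Algebra ℂ R] [Algebra ℂ R']
    {Λ : Finset ℚ} {N : ℕ} (g : R →ₐ[ℂ] R') (φ s : Xi R Λ N) (hs : s ∈ Xi.orbitSpan φ) :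
    Xi.map (g : R →+* R') s ∈ Xi.orbitSpan (Xi.map (g : R →+* R') φ) := by
  induction hs using Submodule.span_induction with
  | mem x hx =>
    obtain ⟨ν, rfl⟩ := hx
    refine Submodule.subset_span ⟨ν, ?_⟩
    exact ((Function.Semiconj.iterate_right (f := Xi.map (g : R →+* R'))
      (fun v => Xi.map_aMap g v) ν) φ).symm
  | zero =>
    have : Xi.map (g : R →+* R') (0 : Xi R Λ N) = 0 := by funext i; simp [Xi.map]
    rw [this]
    exact Submodule.zero_mem _
  | add x y _ _ hx hy =>
    have : Xi.map (g : R →+* R') (x + y) = Xi.map (g : R →+* R') x + Xi.map (g : R →+* R') y := by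
      funext i; simp [Xi.map]
    rw [this]
    exact Submodule.add_mem _ hx hy
  | smul f x _ hx =>
    have : Xi.map (g : R →+* R') (f • x) =
        PowerSeries.map (g : R →+* R') f • Xi.map (g : R →+* R') x := by
      funext i; simp [Xi.map]
    rw [this]
    exact Submodule.smul_mem _ _ hx

/-- Restriction of sections of the sheaf `Ξ_{X,Λ}^{(N)}`. -/
noncomputable def Xi.res {E X : Type*} [NormedAddCommGroup E] [NormedSpace ℂ E]
    [TopologicalSpace X] [ChartedSpace E X] {Λ : Finset ℚ} {N : ℕ} {V W : Opens X} (h : W ≤ V)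
    (v : Xi (Hol E V) Λ N) : Xi (Hol E W) Λ N :=
  Xi.map (Hol.res E h : Hol E V →+* Hol E W) v

/-- The sections over `V ⊆ U` of the subsheaf `𝔼_φ` of `𝒪_X[[b]]`-modules of `Ξ_{X,Λ}^{(N)}` generated
by the `a^ν φ`, `ν ∈ ℕ`, where `φ` is a holomorphic map `U → Ξ_Λ^{(N)}`, i.e. a section of
`Ξ_{X,Λ}^{(N)}` over `U`: the sections that are locally `𝒪_X[[b]]`-combinations of the `a^ν φ`. -/
noncomputable def genSheaf {E X : Type*} [NormedAddCommGroup E] [NormedSpace ℂ E]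
    [TopologicalSpace X] [ChartedSpace E X] {Λ : Finset ℚ} {N : ℕ} {U : Opens X}
    (φ : Xi (Hol E U) Λ N) (V : Opens X) (hV : V ≤ U) :
    Submodule (HolB E V) (Xi (Hol E V) Λ N) where
  carrier := {s | ∀ x ∈ V, ∃ (W : Opens X) (h : W ≤ V), x ∈ W ∧
    Xi.res h s ∈ Xi.orbitSpan (Xi.res (h.trans hV) φ)}
  zero_mem' := by
    intro x hx
    refine ⟨V, le_rfl, hx, ?_⟩
    have : Xi.res (le_rfl : V ≤ V) (0 : Xi (Hol E V) Λ N) = 0 := by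
      funext i; simp [Xi.res, Xi.map]
    rw [this]
    exact Submodule.zero_mem _
  add_mem' := by
    intro s t hs ht x hx
    obtain ⟨W₁, h₁, hx₁, hs₁⟩ := hs x hx
    obtain ⟨W₂, h₂, hx₂, ht₂⟩ := ht x hx
    have key : ∀ (W : Opens X) (h : W ≤ V) (h' : W₁ ⊓ W₂ ≤ W) (u : Xi (Hol E V) Λ N),
        Xi.res h u ∈ Xi.orbitSpan (Xi.res (h.trans hV) φ) →
        Xi.res (h'.trans h) u ∈ Xi.orbitSpan (Xi.res ((h'.trans h).trans hV) φ) := by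
      intro W h h' u hu
      have := Xi.map_orbitSpan (Hol.res E h') _ _ hu
      have hc : ∀ {V' : Opens X} (hh : W ≤ V') (v : Xi (Hol E V') Λ N),
          Xi.map (Hol.res E h' : Hol E W →+* Hol E (W₁ ⊓ W₂ : Opens X)) (Xi.res hh v) =
            Xi.res (h'.trans hh) v := by
        intro V' hh v
        funext i
        ext n
        simp only [Xi.map, Xi.res, PowerSeries.coeff_map]
        rfl
      rwa [hc, hc] at this
    refine ⟨W₁ ⊓ W₂, inf_le_left.trans h₁, ⟨hx₁, hx₂⟩, ?_⟩
    have : Xi.res (inf_le_left.trans h₁ : W₁ ⊓ W₂ ≤ V) (s + t) =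
        Xi.res (inf_le_left.trans h₁ : W₁ ⊓ W₂ ≤ V) s +
          Xi.res (inf_le_left.trans h₁ : W₁ ⊓ W₂ ≤ V) t := by
      funext i; simp [Xi.res, Xi.map]
    rw [this]
    exact Submodule.add_mem _ (key W₁ h₁ inf_le_left s hs₁) (key W₂ h₂ inf_le_right t ht₂)
  smul_mem' := by
    intro f s hs x hx
    obtain ⟨W, h, hxW, hsW⟩ := hs x hx
    refine ⟨W, h, hxW, ?_⟩
    have : Xi.res h (f • s) = HolB.res h f • Xi.res h s := by
      funext i; simp [Xi.res, Xi.map, HolB.res]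
    rw [this]
    exact Submodule.smul_mem _ _ hsW

/-- A holomorphic map `φ : U → Ξ_Λ^{(N)}` is `k`-thematic: the sheaf `𝔼_φ` is free of rank `k` on
`𝒪_X[[b]]` with basis `φ, aφ, …, a^{k-1}φ`, and for each `x ∈ U` the fibre of `𝔼_φ` at `x` is
`Ã φ(x) ⊆ Ξ_Λ^{(N)}`, a theme of rank `k` (the values `φ(x), aφ(x), …, a^{k-1}φ(x)` are independent
on `ℂ[[b]]`). -/
structure IsThematic {E X : Type*} [NormedAddCommGroup E] [NormedSpace ℂ E]
    [TopologicalSpace X] [ChartedSpace E X] {Λ : Finset ℚ} {N : ℕ} {U : Opens X} (k : ℕ)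
    (φ : Xi (Hol E U) Λ N) : Prop where
  linearIndependent : ∀ (V : Opens X) (h : V ≤ U),
    LinearIndependent (HolB E V) (fun i : Fin k => Xi.aMap^[(i : ℕ)] (Xi.res h φ))
  span_eq : ∀ (V : Opens X) (h : V ≤ U),
    Submodule.span (HolB E V) (Set.range fun i : Fin k => Xi.aMap^[(i : ℕ)] (Xi.res h φ)) =
      genSheaf φ V h
  fibre : ∀ x : U, LinearIndependent (PowerSeries ℂ)
    (fun i : Fin k => Xi.aMap^[(i : ℕ)] (Xi.map (Hol.eval E x : Hol E U →+* ℂ) φ))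

/-- A holomorphic family of rank `k` themes: near every point `F` is isomorphic, as a sheaf of
`𝒪_X`-`(a,b)`-modules, to `𝔼_φ` for a `k`-thematic holomorphic map `φ` to some `Ξ_Λ^{(k-1)}` with
`Λ ⊆ ]0,1] ∩ ℚ` finite. The isomorphism is given as an injective morphism to `Ξ_{X,Λ}^{(k-1)}` with
image `𝔼_φ`. -/
def IsHolomorphicFamilyOfThemes {E X : Type} [NormedAddCommGroup E] [NormedSpace ℂ E]
    [TopologicalSpace X] [ChartedSpace E X] (k : ℕ) (F : ABPresheaf E X) : Prop :=
  ∀ x : X, ∃ (U : Opens X) (Λ : Finset ℚ) (φ : Xi (Hol E U) Λ (k - 1))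
    (θ : ∀ V : Opens X, V ≤ U → (F.obj V →ₗ[HolB E V] Xi (Hol E V) Λ (k - 1))),
    x ∈ U ∧ (∀ l ∈ Λ, 0 < l ∧ l ≤ 1) ∧ IsThematic k φ ∧
    (∀ (V : Opens X) (hV : V ≤ U), Function.Injective (θ V hV) ∧
      LinearMap.range (θ V hV) = genSheaf φ V hV) ∧
    (∀ (V : Opens X) (hV : V ≤ U) (s : F.obj V), θ V hV (F.aMap V s) = Xi.aMap (θ V hV s)) ∧
    (∀ (V W : Opens X) (hV : V ≤ U) (h : W ≤ V) (s : F.obj V),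
      θ W (h.trans hV) (F.res h s) = Xi.res h (θ V hV s))

/-- The `ℂ[[b]]`-module `M` with the operator `aM` is a `[λ₁]`-primitive theme of rank `k`: it is free
of rank `k` on `ℂ[[b]]`, generated by one element as an `(a,b)`-module, and it embeds in some
`Ξ_λ^{(N)}` with `λ ∈ ]0,1]`, `λ ∈ λ₁ + ℤ`. -/
def IsPrimitiveTheme (lam1 : ℚ) (k : ℕ) (M : Type) [AddCommGroup M] [Module (PowerSeries ℂ) M]
    (aM : M →+ M) : Prop :=
  Nonempty (Module.Basis (Fin k) (PowerSeries ℂ) M) ∧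
  (∃ e : M, Submodule.span (PowerSeries ℂ) (Set.range fun ν : ℕ => aM^[ν] e) = ⊤) ∧
  ∃ (l : ℚ) (N : ℕ) (θ : M →ₗ[PowerSeries ℂ] Xi ℂ {l} N), 0 < l ∧ l ≤ 1 ∧
    (∃ m : ℤ, lam1 = l + m) ∧ Function.Injective θ ∧ ∀ m : M, θ (aM m) = Xi.aMap (θ m)

/-! ### The parameter space -/

/-- The exponents of the basis of `V_j`, for `1 ≤ j ≤ k - 1`: these are `0, …, k - j - 1` and, if
`p_j + ⋯ + p_{k-1} ≥ k - j`, also `q_j = p_j + ⋯ + p_{j+h}` with `h` minimal such that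
`q_j ≥ k - j`. -/
noncomputable def expV (k : ℕ) (p : ℕ → ℕ) (j : ℕ) : Finset ℕ :=
  if ∑ i ∈ Finset.Icc j (k - 1), p i < k - j then Finset.range (k - j)
  else insert (∑ i ∈ Finset.Icc j (j + sInf {h | k - j ≤ ∑ i ∈ Finset.Icc j (j + h), p i}), p i)
    (Finset.range (k - j))

/-- The parameter space `𝒮(λ₁, p₁, …, p_{k-1})` (it does not depend on `λ₁`): the families
`(S_1, …, S_{k-1})` with `S_j ∈ V_j`, `S_j(0) = 1` and nonzero coefficient of `b ^ p_j`. -/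
def paramSpace (k : ℕ) (p : ℕ → ℕ) : Set (Finset.Icc 1 (k - 1) → PowerSeries ℂ) :=
  {S | ∀ j : Finset.Icc 1 (k - 1), S j ∈ Submodule.span ℂ ((fun n : ℕ => (PowerSeries.X : PowerSeries ℂ) ^ n) ''
      (expV k p j : Set ℕ)) ∧
    PowerSeries.constantCoeff (S j) = 1 ∧ PowerSeries.coeff (p j) (S j) ≠ 0}

/-- The index set of the free coordinates of `𝒮`: the pairs `(j, n)`, with `1 ≤ j ≤ k - 1` and `n ≠ 0`
an exponent of `V_j`. -/
abbrev CoordIdx (k : ℕ) (p : ℕ → ℕ) : Type :=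
  (Finset.Icc 1 (k - 1)).sigma fun j => (expV k p j).erase 0

/-- The series `S_j = 1 + ∑ s_{j,n} b ^ n` with coordinates `s` (equal to `1` for `j` outside
`[1, k - 1]`). -/
noncomputable def seriesOf {k : ℕ} {p : ℕ → ℕ} (s : CoordIdx k p → ℂ) (j : ℕ) : PowerSeries ℂ :=
  PowerSeries.mk fun n => if n = 0 then 1 else
    if h : (⟨j, n⟩ : Σ _ : ℕ, ℕ) ∈ (Finset.Icc 1 (k - 1)).sigma fun j => (expV k p j).erase 0
    then s ⟨⟨j, n⟩, h⟩ else 0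

theorem continuous_coeff_seriesOf {k : ℕ} {p : ℕ → ℕ} (j n : ℕ) :
    Continuous fun s : CoordIdx k p → ℂ => PowerSeries.coeff n (seriesOf s j) := by
  simp only [seriesOf, PowerSeries.coeff_mk]
  split_ifs <;> fun_prop

/-- The parameter space as an open subset of the affine space of its coordinates. -/
def paramOpens (k : ℕ) (p : ℕ → ℕ) : Opens (CoordIdx k p → ℂ) where
  carrier := {s | ∀ j ∈ Finset.Icc 1 (k - 1), PowerSeries.coeff (p j) (seriesOf s j) ≠ 0}
  is_open' := by
    simp only [Set.ofPred_forall]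
    exact isOpen_biInter_finset fun j _ =>
      isOpen_ne_fun (continuous_coeff_seriesOf j (p j)) continuous_const

/-- The coordinates identify `paramOpens k p` with the parameter space. -/
theorem bijOn_seriesOf (k : ℕ) (p : ℕ → ℕ) :
    Set.BijOn (fun (s : CoordIdx k p → ℂ) (j : Finset.Icc 1 (k - 1)) => seriesOf s j)
      (paramOpens k p) (paramSpace k p) := by
  have hspan : ∀ (A : Finset ℕ) (f : PowerSeries ℂ),
      f ∈ Submodule.span ℂ ((fun n : ℕ => (PowerSeries.X : PowerSeries ℂ) ^ n) '' (A : Set ℕ)) ↔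
        ∀ n, n ∉ A → PowerSeries.coeff n f = 0 := by
    intro A f
    constructor
    · intro hf
      induction hf using Submodule.span_induction with
      | mem x hx =>
        obtain ⟨m, hm, rfl⟩ := hx
        intro n hn
        rw [PowerSeries.coeff_X_pow, if_neg]
        rintro rfl
        exact hn hm
      | zero => intro n _; simp
      | add x y _ _ hx hy => intro n hn; simp [hx n hn, hy n hn]
      | smul c x _ hx => intro n hn; simp [hx n hn]
    · intro h
      have : f = ∑ n ∈ A, PowerSeries.coeff n f • (PowerSeries.X : PowerSeries ℂ) ^ n := by
        ext m
        rw [map_sum]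
        simp only [PowerSeries.coeff_smul, PowerSeries.coeff_X_pow, smul_eq_mul, mul_ite, mul_one,
          mul_zero, Finset.sum_ite_eq]
        split_ifs with hm
        · rfl
        · exact h m hm
      rw [this]
      exact Submodule.sum_mem _ fun n hn =>
        Submodule.smul_mem _ _ (Submodule.subset_span ⟨n, hn, rfl⟩)
  have hzero : ∀ j ∈ Finset.Icc 1 (k - 1), 0 ∈ expV k p j := by
    intro j hj
    rw [Finset.mem_Icc] at hj
    unfold expV
    split_ifs
    · rw [Finset.mem_range]; omega
    · rw [Finset.mem_insert, Finset.mem_range]; right; omega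
  refine ⟨?_, ?_, ?_⟩
  · intro s hs j
    refine ⟨?_, ?_, hs j j.2⟩
    · rw [hspan]
      intro n hn
      have hn0 : n ≠ 0 := fun h0 => hn (h0 ▸ hzero j j.2)
      simp only [seriesOf, PowerSeries.coeff_mk, if_neg hn0]
      rw [dif_neg]
      simp [hn]
    · rw [← PowerSeries.coeff_zero_eq_constantCoeff_apply]
      simp [seriesOf]
  · intro s _ t _ hst
    funext ⟨⟨j, n⟩, h⟩
    have h' := Finset.mem_sigma.mp h
    have hn0 : n ≠ 0 := (Finset.mem_erase.mp h'.2).1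
    have := congrArg (PowerSeries.coeff n) (congrFun hst ⟨j, h'.1⟩)
    simpa only [seriesOf, PowerSeries.coeff_mk, if_neg hn0, dif_pos h] using this
  · intro S hS
    have key : ∀ j : Finset.Icc 1 (k - 1), seriesOf (fun i : CoordIdx k p =>
        PowerSeries.coeff i.1.2 (S ⟨i.1.1, (Finset.mem_sigma.mp i.2).1⟩)) j = S j := by
      intro j
      obtain ⟨h1, h2, -⟩ := hS j
      ext n
      simp only [seriesOf, PowerSeries.coeff_mk]
      split_ifs with hn h
      · rw [hn, PowerSeries.coeff_zero_eq_constantCoeff_apply, h2]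
      · rfl
      · refine ((hspan _ _).mp h1 n fun hmem => h ?_).symm
        exact Finset.mem_sigma.mpr ⟨j.2, Finset.mem_erase.mpr ⟨hn, hmem⟩⟩
    refine ⟨_, ?_, funext key⟩
    intro j hj
    have := (hS ⟨j, hj⟩).2.2
    rwa [← key ⟨j, hj⟩] at this

/-! ### The canonical family -/

/-- `λ_1, λ_2, …` with `λ_{j+1} = λ_j + p_j - 1` (the value at `0` is not used). -/
def lamSeq (lam1 : ℚ) (p : ℕ → ℕ) : ℕ → ℚ
  | 0 => lam1
  | 1 => lam1
  | n + 2 => lamSeq lam1 p (n + 1) + p (n + 1) - 1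

/-- `P(σ) = (a - λ₁ b) S₁⁻¹ ⋯ S_{k-1}⁻¹ (a - λ_k b) ∈ Ã`. -/
noncomputable def canonP {k : ℕ} {p : ℕ → ℕ} (lam1 : ℚ) (σ : paramOpens k p) : ATilde ℂ :=
  thetaP (lamSeq lam1 p) (seriesOf (σ : CoordIdx k p → ℂ)) (k - 1)

/-- `E(σ) = Ã / Ã P(σ)`. -/
abbrev canonE {k : ℕ} {p : ℕ → ℕ} (lam1 : ℚ) (σ : paramOpens k p) : Type :=
  Cyc ℂ (canonP lam1 σ)

theorem contMDiff_coeff_seriesOf {k : ℕ} {p : ℕ → ℕ} (V : Opens (paramOpens k p)) (j n : ℕ) :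
    ContMDiff 𝓘(ℂ, CoordIdx k p → ℂ) 𝓘(ℂ, ℂ) ω
      fun x : V => PowerSeries.coeff n (seriesOf (x : paramOpens k p).1 j) := by
  have hval : ContMDiff 𝓘(ℂ, CoordIdx k p → ℂ) 𝓘(ℂ, CoordIdx k p → ℂ) ω
      fun x : V => ((x : paramOpens k p) : CoordIdx k p → ℂ) :=
    contMDiff_subtype_val.comp contMDiff_subtype_val
  simp only [seriesOf, PowerSeries.coeff_mk]
  split_ifs with h1 h2
  · exact contMDiff_const
  · exact (ContinuousLinearMap.proj (R := ℂ) (φ := fun _ : CoordIdx k p => ℂ)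
      ⟨⟨j, n⟩, h2⟩).contMDiff.comp hval
  · exact contMDiff_const

/-- The coefficient of `b ^ n` in `S_j`, as a holomorphic function on `V`. -/
noncomputable def tautCoeff {k : ℕ} {p : ℕ → ℕ} (V : Opens (paramOpens k p)) (j n : ℕ) :
    Hol (CoordIdx k p → ℂ) V :=
  ⟨fun x : V => PowerSeries.coeff n (seriesOf (x : paramOpens k p).1 j),
    contMDiff_coeff_seriesOf V j n⟩

/-- The tautological series `S_j ∈ 𝒪(V)[[b]]` on an open subset `V` of the parameter space. -/
noncomputable def tautSeries {k : ℕ} {p : ℕ → ℕ} (V : Opens (paramOpens k p)) (j : ℕ) :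
    HolB (CoordIdx k p → ℂ) V :=
  PowerSeries.mk (tautCoeff V j)

theorem constantCoeff_tautSeries {k : ℕ} {p : ℕ → ℕ} (V : Opens (paramOpens k p)) (j : ℕ) :
    PowerSeries.constantCoeff (tautSeries V j) = 1 := by
  rw [← PowerSeries.coeff_zero_eq_constantCoeff_apply, tautSeries, PowerSeries.coeff_mk]
  ext x
  change PowerSeries.coeff 0 (seriesOf _ j) = 1
  simp [seriesOf]

/-- The operator `P` with holomorphic coefficients on `V`. -/
noncomputable def canonPOn {k : ℕ} {p : ℕ → ℕ} (lam1 : ℚ) (V : Opens (paramOpens k p)) :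
    ATilde (Hol (CoordIdx k p → ℂ) V) :=
  thetaP (lamSeq lam1 p) (tautSeries V) (k - 1)

theorem map_res_canonPOn {k : ℕ} {p : ℕ → ℕ} (lam1 : ℚ) {V W : Opens (paramOpens k p)}
    (h : W ≤ V) :
    ATilde.map (Hol.res (CoordIdx k p → ℂ) h : Hol (CoordIdx k p → ℂ) V →+* Hol (CoordIdx k p → ℂ) W)
      (canonPOn lam1 V) = canonPOn lam1 W := by
  rw [canonPOn, map_thetaP _ _ _ (constantCoeff_tautSeries V)]
  congr 1

/-- The restriction maps of the canonical family. -/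
noncomputable def canonRes {k : ℕ} {p : ℕ → ℕ} (lam1 : ℚ) {V W : Opens (paramOpens k p)}
    (h : W ≤ V) : Cyc (Hol (CoordIdx k p → ℂ) V) (canonPOn lam1 V) →+
      Cyc (Hol (CoordIdx k p → ℂ) W) (canonPOn lam1 W) :=
  Cyc.map (Hol.res (CoordIdx k p → ℂ) h :
    Hol (CoordIdx k p → ℂ) V →+* Hol (CoordIdx k p → ℂ) W) (map_res_canonPOn lam1 h)

/-- The canonical family as a presheaf on the parameter space:
`V ↦ Ã_{𝒪(V)} / Ã_{𝒪(V)} P`. -/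
noncomputable def canonicalFamily (k : ℕ) (lam1 : ℚ) (p : ℕ → ℕ) :
    ABPresheaf (CoordIdx k p → ℂ) (paramOpens k p) where
  obj V := Cyc (Hol (CoordIdx k p → ℂ) V) (canonPOn lam1 V)
  aMap V := Cyc.aAct (canonPOn lam1 V)
  res h := canonRes lam1 h

end ABTheme

/-!
Modulo `b`, the operator `P` is the monic polynomial `a ^ k`, so division with remainder shows that
`1, a, …, a ^ (k - 1)` is an `R[[b]]`-basis of `Ã_R / Ã_R P`, compatible with change of `R`.
Sections of `𝔼` are thus sequences of holomorphic functions, which gives the sheaf property and the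
fibres.

The classes of the right factors of `P` form another basis `e_0, …, e_{k-1}`, characterised by
`a e_0 = λ_1 b e_0` and `a e_{i+1} = λ_{i+2} b e_{i+1} + S_{i+1} e_i`. Solving these equations in
`Ξ_λ`, degree by degree in `b`, maps `Ã_R / Ã_R P` to `Ξ_λ`. Each resonance raises the degree in
the logarithm by one, so the solutions are triangular in the basis `e_{λ,j}`, and their diagonal
coordinates are powers of `b` times products of the coefficients of `b ^ {p_j}` in `S_j`. On `𝒮`
these do not vanish, so the map is injective; its image is generated by the image of `e_{k-1}`,
which is the thematic section.
-/

namespace ABTheme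

open TopologicalSpace PowerSeries

/-! ### Division with remainder in `Ã_R` -/

section Division

variable {R : Type*} [CommRing R]

theorem coeff_zero_aeval_leftA (p : Polynomial R) (v : PowerSeries (Polynomial R)) :
    coeff 0 (Polynomial.aeval (leftA R) p v) = p * coeff 0 v := by
  have coeff_zero_pow (m : ℕ) : coeff 0 ((leftA R ^ m) v) = Polynomial.X ^ m * coeff 0 v := by
    induction m with
    | zero => simp
    | succ m ih => rw [pow_succ', Module.End.mul_apply, coeff_leftA_zero, ih, pow_succ', mul_assoc]
  induction p using Polynomial.induction_on' with
  | add p q hp hq => simp only [map_add, LinearMap.add_apply, hp, hq, add_mul]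
  | monomial n r =>
    rw [Polynomial.aeval_monomial, Module.End.mul_apply, Module.algebraMap_end_apply,
      coeff_smul, coeff_zero_pow, Polynomial.smul_eq_C_mul, ← Polynomial.C_mul_X_pow_eq_monomial,
      mul_assoc]

theorem coeff_mulSeries_eq_mul_add_sum (u v : PowerSeries (Polynomial R)) (n : ℕ) :
    coeff n (mulSeries u v) = coeff n u * coeff 0 v +
      ∑ i : Fin n, coeff (n - i) (Polynomial.aeval (leftA R) (coeff i u) v) := by
  rw [coeff_mulSeries, Finset.Nat.sum_antidiagonal_eq_sum_range_succ_mk, Finset.sum_range_succ,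
    Nat.sub_self, coeff_zero_aeval_leftA, add_comm, Finset.sum_range]

namespace ATilde

/-- The additive group underlying `Ã_R`: the coefficient series of an element. -/
noncomputable def seriesHom (R : Type*) [CommRing R] :
    ATilde R →+ PowerSeries (Polynomial R) where
  toFun := series
  map_zero' := rfl
  map_add' := series_add

theorem series_sub (u v : ATilde R) : (u - v).series = u.series - v.series :=
  map_sub (seriesHom R) u v

theorem series_sum {ι : Type*} (s : Finset ι) (u : ι → ATilde R) :
    (∑ i ∈ s, u i).series = ∑ i ∈ s, (u i).series :=
  map_sum (seriesHom R) u s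

/-- Reduction modulo `b`, the ring homomorphism `Ã_R → Ã_R / b Ã_R = R[a]`. -/
noncomputable def modB (R : Type*) [CommRing R] : ATilde R →+* Polynomial R where
  toFun u := coeff 0 u.series
  map_one' := coeff_zero_one
  map_zero' := map_zero _
  map_add' u v := by rw [series_add, map_add]
  map_mul' u v := by rw [series_mul, coeff_mulSeries_eq_mul_add_sum, Fin.sum_univ_zero, add_zero]

theorem modB_a : modB R (a R) = Polynomial.X := coeff_zero_C _

theorem modB_ofSeries (f : PowerSeries R) :
    modB R (ofSeries R f) = Polynomial.C (constantCoeff f) := by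
  change coeff 0 (PowerSeries.map Polynomial.C f) = _
  rw [coeff_map, coeff_zero_eq_constantCoeff_apply]

/-- `P` is congruent modulo `b` to a monic polynomial of degree `k` in `a`. The formulation by the
degree of the difference with `a ^ k` remains correct over the zero ring, such as the ring of
functions on the empty set. -/
def IsMonicModB (P : ATilde R) (k : ℕ) : Prop :=
  (modB R P - Polynomial.X ^ k).degree < (k : WithBot ℕ)

variable {P : ATilde R} {k : ℕ}

theorem IsMonicModB.monic (hP : P.IsMonicModB k) : (modB R P).Monic := by
  simpa using Polynomial.monic_X_pow_add hP

theorem IsMonicModB.degree_modB [Nontrivial R] (hP : P.IsMonicModB k) :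
    (modB R P).degree = k := by
  simpa using Polynomial.degree_add_eq_left_of_degree_lt
    (hP.trans_eq (Polynomial.degree_X_pow (R := R) k).symm)

/-- The coefficients of the quotient in the division of `u` by `P`: the coefficient of `b ^ n` is
found by dividing, modulo `b`, what the lower coefficients leave of `u`. -/
noncomputable def quotCoeff (P u : ATilde R) (n : ℕ) : Polynomial R :=
  (coeff n u.series - ∑ i : Fin n, coeff (n - i)
    (Polynomial.aeval (leftA R) (quotCoeff P u i) P.series)) /ₘ modB R P
decreasing_by exact i.2

theorem degree_coeff_sub_quotCoeff_mul_lt (hP : P.IsMonicModB k) (u : ATilde R) (n : ℕ) :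
    (coeff n (u - ⟨PowerSeries.mk (quotCoeff P u)⟩ * P).series).degree < k := by
  nontriviality R
  let w := coeff n u.series - ∑ i : Fin n, coeff (n - i)
    (Polynomial.aeval (leftA R) (quotCoeff P u i) P.series)
  have quotCoeff_eq : quotCoeff P u n = w /ₘ modB R P := by rw [quotCoeff]
  have coeff_eq_mod : coeff n (u - ⟨PowerSeries.mk (quotCoeff P u)⟩ * P).series =
      w %ₘ modB R P := by
    rw [eq_sub_of_add_eq (Polynomial.modByMonic_add_div w (modB R P)), ← quotCoeff_eq, series_sub,
      map_sub, series_mul, coeff_mulSeries_eq_mul_add_sum, mul_comm, sub_add_eq_sub_sub_swap]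
    simp only [coeff_mk]
    rfl
  rw [coeff_eq_mod, ← hP.degree_modB]
  exact Polynomial.degree_modByMonic_lt _ hP.monic

theorem eq_zero_of_degree_coeff_mul_lt (hP : P.IsMonicModB k) {q : ATilde R}
    (hq : ∀ n, (coeff n (q * P).series).degree < k) : q = 0 := by
  have coeff_eq_zero (n : ℕ) : coeff n q.series = 0 := by
    induction n using Nat.strong_induction_on with
    | _ n ih =>
      nontriviality R
      have hn := hq n
      rw [series_mul, coeff_mulSeries_eq_mul_add_sum,
        Finset.sum_eq_zero fun i _ => by rw [ih i i.2, map_zero]; rfl, add_zero] at hn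
      by_contra hne
      change (_ * modB R P).degree < _ at hn
      rw [hP.monic.degree_mul, hP.degree_modB, Polynomial.degree_eq_natDegree hne] at hn
      norm_cast at hn
      omega
  exact ATilde.ext (PowerSeries.ext coeff_eq_zero)

theorem series_a_pow (i : ℕ) : (a R ^ i).series = C (Polynomial.X ^ i) := by
  induction i with
  | zero => exact (map_one C).symm
  | succ i ih => rw [pow_succ', series_a_mul, ih, pow_succ']; simp [leftA]

theorem coeff_series_sum_ofSeries_mul_a_pow (f : Fin k → PowerSeries R) (n : ℕ) :
    coeff n (∑ i, ofSeries R (f i) * a R ^ (i : ℕ)).series =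
      ∑ i : Fin k, Polynomial.C (coeff n (f i)) * Polynomial.X ^ (i : ℕ) := by
  simp only [series_sum, map_sum, series_ofSeries_mul, series_a_pow, coeff_mul_C, coeff_map]

theorem coeff_coeff_series_sum_ofSeries_mul_a_pow (f : Fin k → PowerSeries R) (n : ℕ)
    (j : Fin k) :
    (coeff n (∑ i, ofSeries R (f i) * a R ^ (i : ℕ)).series).coeff j = coeff n (f j) := by
  simp [coeff_series_sum_ofSeries_mul_a_pow, Polynomial.coeff_X_pow, Fin.val_inj]

theorem degree_coeff_series_sum_lt (f : Fin k → PowerSeries R) (n : ℕ) :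
    (coeff n (∑ i, ofSeries R (f i) * a R ^ (i : ℕ)).series).degree < k := by
  rw [coeff_series_sum_ofSeries_mul_a_pow]
  exact Polynomial.degree_sum_fin_lt _

theorem eq_sum_ofSeries_mul_a_pow {u : ATilde R} (hu : ∀ n, (coeff n u.series).degree < k) :
    u = ∑ i : Fin k,
      ofSeries R (PowerSeries.mk fun n => (coeff n u.series).coeff i) * a R ^ (i : ℕ) := by
  refine ATilde.ext (PowerSeries.ext fun n => ?_)
  simp only [coeff_series_sum_ofSeries_mul_a_pow, coeff_mk, Polynomial.C_mul_X_pow_eq_monomial]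
  rw [Polynomial.sum_fin _ (fun i => map_zero _) (hu n), Polynomial.sum_monomial_eq]

end ATilde

namespace Cyc

theorem smul_mk (P : ATilde R) (f : PowerSeries R) (u : ATilde R) :
    f • (Submodule.Quotient.mk u : Cyc R P) =
      Submodule.Quotient.mk (ATilde.ofSeries R f * u) := rfl

theorem sum_smul_mk (P : ATilde R) {ι : Type*} (s : Finset ι) (f : ι → PowerSeries R)
    (u : ι → ATilde R) :
    ∑ i ∈ s, f i • (Submodule.Quotient.mk (u i) : Cyc R P) =
      Submodule.Quotient.mk (∑ i ∈ s, ATilde.ofSeries R (f i) * u i) :=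
  (map_sum (Submodule.mkQ _) _ s).symm

variable {P : ATilde R} {k : ℕ} (hP : P.IsMonicModB k)
include hP

theorem linearIndependent_a_pow :
    LinearIndependent (PowerSeries R)
      fun i : Fin k => (Submodule.Quotient.mk (ATilde.a R ^ (i : ℕ)) : Cyc R P) := by
  rw [Fintype.linearIndependent_iff]
  intro f hf i
  rw [sum_smul_mk, Submodule.Quotient.mk_eq_zero, Ideal.mem_span_singleton'] at hf
  obtain ⟨q, hq⟩ := hf
  have q_eq_zero : q = 0 := ATilde.eq_zero_of_degree_coeff_mul_lt hP fun n =>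
    hq ▸ ATilde.degree_coeff_series_sum_lt f n
  ext n
  rw [← ATilde.coeff_coeff_series_sum_ofSeries_mul_a_pow, ← hq, q_eq_zero, zero_mul, map_zero]
  rfl

theorem span_a_pow :
    Submodule.span (PowerSeries R) (Set.range fun i : Fin k =>
      (Submodule.Quotient.mk (ATilde.a R ^ (i : ℕ)) : Cyc R P)) = ⊤ := by
  refine eq_top_iff.2 fun x _ => ?_
  obtain ⟨u, rfl⟩ := Submodule.Quotient.mk_surjective _ x
  let r : ATilde R := u - ⟨PowerSeries.mk (ATilde.quotCoeff P u)⟩ * P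
  have mk_eq : (Submodule.Quotient.mk u : Cyc R P) = Submodule.Quotient.mk r :=
    (Submodule.Quotient.eq _).2 <| Ideal.mem_span_singleton'.2 ⟨_, (sub_sub_cancel _ _).symm⟩
  have degree_lt (n : ℕ) : (coeff n r.series).degree < k :=
    ATilde.degree_coeff_sub_quotCoeff_mul_lt hP u n
  rw [mk_eq, ATilde.eq_sum_ofSeries_mul_a_pow degree_lt, ← sum_smul_mk]
  exact Submodule.sum_mem _ fun i _ => Submodule.smul_mem _ _ (Submodule.subset_span ⟨i, rfl⟩)

/-- The basis `1, a, …, a ^ (k - 1)` of `Ã_R / Ã_R P` on `R[[b]]`, for `P` monic of degree `k`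
modulo `b`. -/
noncomputable def powBasis : Module.Basis (Fin k) (PowerSeries R) (Cyc R P) :=
  Module.Basis.mk (linearIndependent_a_pow hP) (span_a_pow hP).ge

theorem powBasis_apply (i : Fin k) :
    powBasis hP i = Submodule.Quotient.mk (ATilde.a R ^ (i : ℕ)) :=
  Module.Basis.mk_apply _ _ i

end Cyc

end Division

/-! ### Base change and the action of `a` -/

section BaseChange

variable {R R' : Type*} [CommRing R] [CommRing R'] (g : R →+* R')

theorem ATilde.modB_map (u : ATilde R) :
    modB R' (ATilde.map g u) = (modB R u).map g := by
  change coeff 0 (PowerSeries.map (Polynomial.mapRingHom g) u.series) = _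
  rw [coeff_map]
  rfl

theorem ATilde.IsMonicModB.map {P : ATilde R} {k : ℕ} (hP : P.IsMonicModB k) :
    (ATilde.map g P).IsMonicModB k := by
  have sub_eq : modB R' (ATilde.map g P) - Polynomial.X ^ k =
      (modB R P - Polynomial.X ^ k).map g := by simp [modB_map]
  rw [IsMonicModB, sub_eq]
  exact Polynomial.degree_map_le.trans_lt hP

namespace Cyc

variable {P : ATilde R} {P' : ATilde R'} (h : ATilde.map g P = P')

theorem map_mk (u : ATilde R) :
    Cyc.map g h (Submodule.Quotient.mk u) = Submodule.Quotient.mk (ATilde.map g u) := rfl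

theorem map_smul (f : PowerSeries R) (s : Cyc R P) :
    Cyc.map g h (f • s) = PowerSeries.map g f • Cyc.map g h s := by
  obtain ⟨u, rfl⟩ := Submodule.Quotient.mk_surjective _ s
  rw [smul_mk, map_mk, map_mk, smul_mk, _root_.map_mul, ATilde.map_ofSeries]

theorem aAct_mk (P : ATilde R) (u : ATilde R) :
    Cyc.aAct P (Submodule.Quotient.mk u) = Submodule.Quotient.mk (ATilde.a R * u) := rfl

theorem map_aAct (s : Cyc R P) :
    Cyc.map g h (Cyc.aAct P s) = Cyc.aAct P' (Cyc.map g h s) := by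
  obtain ⟨u, rfl⟩ := Submodule.Quotient.mk_surjective _ s
  rw [aAct_mk, map_mk, map_mk, aAct_mk, map_mul, ATilde.map_a]

theorem map_powBasis {k : ℕ} (hP : P.IsMonicModB k) (hP' : P'.IsMonicModB k) (i : Fin k) :
    Cyc.map g h (powBasis hP i) = powBasis hP' i := by
  rw [powBasis_apply, powBasis_apply, map_mk, map_pow, ATilde.map_a]

theorem powBasis_repr_map {k : ℕ} (hP : P.IsMonicModB k) (hP' : P'.IsMonicModB k) (s : Cyc R P)
    (i : Fin k) :
    (powBasis hP').repr (Cyc.map g h s) i = PowerSeries.map g ((powBasis hP).repr s i) := by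
  have map_eq_sum : Cyc.map g h s =
      ∑ j, PowerSeries.map g ((powBasis hP).repr s j) • powBasis hP' j := by
    conv_lhs => rw [← (powBasis hP).sum_repr s]
    simp only [map_sum, map_smul, map_powBasis g h hP hP']
  rw [map_eq_sum, Module.Basis.repr_sum_self]

end Cyc

end BaseChange

section ABOperator

/-- An operator `a` on an `R[[b]]`-module with `a f = f a + b² f'` for `f ∈ R[[b]]`, i.e. an
`R`-linear operator with `a b - b a = b²` that is continuous for the `b`-adic topology. -/
structure IsABOperator (R : Type*) [CommRing R] {M : Type*} [AddCommGroup M]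
    [Module (PowerSeries R) M] (aM : M → M) : Prop where
  add : ∀ v w, aM (v + w) = aM v + aM w
  leibniz : ∀ (f : PowerSeries R) (v : M), aM (f • v) = f • aM v + (X ^ 2 * derivative R f) • v

variable {R : Type*} [CommRing R]

namespace IsABOperator

variable {M : Type*} [AddCommGroup M] [Module (PowerSeries R) M] {aM : M → M}
  (ha : IsABOperator R aM)
include ha

theorem map_zero : aM 0 = 0 := by simpa using ha.leibniz 0 0

theorem map_C_smul (r : R) (v : M) : aM (C r • v) = (C r : PowerSeries R) • aM v := by
  rw [ha.leibniz, derivative_C, mul_zero, zero_smul, add_zero]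

theorem map_X_smul_sub (v : M) :
    aM ((X : PowerSeries R) • v) - (X : PowerSeries R) • aM v = (X ^ 2 : PowerSeries R) • v := by
  rw [ha.leibniz, derivative_X, mul_one, add_sub_cancel_left]

theorem exists_map_X_pow_smul (n : ℕ) (v : M) :
    ∃ w, aM ((X ^ n : PowerSeries R) • v) = (X ^ n : PowerSeries R) • w := by
  refine ⟨aM v + ((n : PowerSeries R) * X) • v, ?_⟩
  rw [ha.leibniz, smul_add, smul_smul]
  congr 2
  rcases n with - | n
  · simp
  · simp
    ring

theorem map_mem_span {s : Set M} (hs : ∀ v ∈ s, aM v ∈ Submodule.span (PowerSeries R) s) {v : M}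
    (hv : v ∈ Submodule.span (PowerSeries R) s) : aM v ∈ Submodule.span (PowerSeries R) s := by
  induction hv using Submodule.span_induction with
  | mem x hx => exact hs x hx
  | zero => rw [ha.map_zero]; exact Submodule.zero_mem _
  | add x y _ _ hx hy => exact ha.add x y ▸ Submodule.add_mem _ hx hy
  | smul f x hx ihx =>
    exact ha.leibniz f x ▸ Submodule.add_mem _ (Submodule.smul_mem _ _ ihx)
      (Submodule.smul_mem _ _ hx)

theorem iterate_mem_span {s : Set M} (hs : ∀ v ∈ s, aM v ∈ Submodule.span (PowerSeries R) s)
    {v : M} (hv : v ∈ s) (ν : ℕ) : aM^[ν] v ∈ Submodule.span (PowerSeries R) s := by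
  induction ν with
  | zero => exact Submodule.subset_span hv
  | succ ν ih => exact Function.iterate_succ_apply' aM ν v ▸ ha.map_mem_span hs ih

end IsABOperator

theorem ATilde.a_mul_ofSeries_mul (f : PowerSeries R) (u : ATilde R) :
    ATilde.a R * (ATilde.ofSeries R f * u) = ATilde.ofSeries R f * (ATilde.a R * u) +
      ATilde.ofSeries R (X ^ 2 * derivative R f) * u := by
  have derivative_map : derivative (Polynomial R) (PowerSeries.map Polynomial.C f) =
      PowerSeries.map Polynomial.C (derivative R f) := by
    ext n : 1
    simp [coeff_derivative]
  refine ATilde.ext ?_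
  rw [ATilde.series_add, ATilde.series_ofSeries_mul, ATilde.series_ofSeries_mul,
    ATilde.series_a_mul, ATilde.series_a_mul, ATilde.series_ofSeries_mul]
  simp only [leftA, LinearMap.coe_mk, AddHom.coe_mk, Derivation.leibniz, smul_eq_mul, map_mul,
    map_pow, PowerSeries.map_X, derivative_map]
  ring

theorem Cyc.isABOperator_aAct (P : ATilde R) : IsABOperator R (Cyc.aAct P) where
  add := map_add _
  leibniz f s := by
    obtain ⟨u, rfl⟩ := Submodule.Quotient.mk_surjective _ s
    simp only [smul_mk, aAct_mk, ATilde.a_mul_ofSeries_mul, Submodule.Quotient.mk_add]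

theorem Cyc.iterate_aAct_one (P : ATilde R) (i : ℕ) :
    (Cyc.aAct P)^[i] (Submodule.Quotient.mk 1) = Submodule.Quotient.mk (ATilde.a R ^ i) := by
  induction i with
  | zero => rw [Function.iterate_zero_apply, pow_zero]
  | succ i ih => rw [Function.iterate_succ_apply', ih, aAct_mk, pow_succ']

theorem Cyc.powBasis_eq_iterate {P : ATilde R} {k : ℕ} (hP : P.IsMonicModB k) (i : Fin k) :
    powBasis hP i = (Cyc.aAct P)^[i] (Submodule.Quotient.mk 1) := by
  rw [powBasis_apply, iterate_aAct_one]

theorem Xi.isABOperator_aMap [Algebra ℂ R] {Λ : Finset ℚ} {N : ℕ} :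
    IsABOperator R (Xi.aMap : Xi R Λ N → Xi R Λ N) where
  add v w := by
    funext i
    simp only [Xi.aMap, Pi.add_apply, map_add]
    split_ifs <;> ring
  leibniz f v := by
    funext i
    simp only [Xi.aMap, Pi.add_apply, Pi.smul_apply, smul_eq_mul, Derivation.leibniz]
    split_ifs <;> ring

end ABOperator

/-! ### Right factors and chains -/

section Theta

variable {R : Type*} [CommRing R] [Algebra ℂ R]

/-- The multiplier `λ_i b` of `R[[b]]`. -/
noncomputable def lamB (R : Type*) [CommRing R] [Algebra ℂ R] (lam : ℕ → ℚ) (i : ℕ) :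
    PowerSeries R :=
  C (algebraMap ℂ R (lam i)) * X

variable (lam : ℕ → ℚ) (S : ℕ → PowerSeries R)

theorem thetaP_zero : thetaP lam S 0 = ATilde.a R - ATilde.ofSeries R (lamB R lam 1) := by
  rw [thetaP, lamB, map_mul, ATilde.ofSeries_X]

theorem thetaP_succ (n : ℕ) :
    thetaP lam S (n + 1) = thetaP lam S n * ATilde.ofSeries R (invOfUnit (S (n + 1)) 1) *
      (ATilde.a R - ATilde.ofSeries R (lamB R lam (n + 2))) := by
  rw [thetaP, lamB, map_mul, ATilde.ofSeries_X, mul_assoc]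

theorem modB_thetaP (n : ℕ) : ATilde.modB R (thetaP lam S n) = Polynomial.X ^ (n + 1) := by
  have constantCoeff_lamB (i : ℕ) : constantCoeff (lamB R lam i) = 0 := by simp [lamB]
  induction n with
  | zero => simp [thetaP_zero, ATilde.modB_a, ATilde.modB_ofSeries, constantCoeff_lamB]
  | succ n ih =>
    simp [thetaP_succ, ih, ATilde.modB_a, ATilde.modB_ofSeries, constantCoeff_lamB, pow_succ]

theorem isMonicModB_thetaP (n : ℕ) : (thetaP lam S n).IsMonicModB (n + 1) := by
  rw [ATilde.IsMonicModB, modB_thetaP, sub_self, Polynomial.degree_zero]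
  exact WithBot.bot_lt_coe _

/-- The product `S_{i+1}⁻¹ (a - λ_{i+2} b) ⋯ S_{i+m}⁻¹ (a - λ_{i+m+1} b)` of the last `m` of the
linear factors of `thetaP lam S (i + m)`. -/
noncomputable def thetaTail (i : ℕ) : ℕ → ATilde R
  | 0 => 1
  | m + 1 => ATilde.ofSeries R (invOfUnit (S (i + 1)) 1) *
      ((ATilde.a R - ATilde.ofSeries R (lamB R lam (i + 2))) * thetaTail (i + 1) m)

theorem thetaP_add (i m : ℕ) :
    thetaP lam S (i + m) = thetaP lam S i * thetaTail lam S i m := by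
  induction m generalizing i with
  | zero => rw [thetaTail, mul_one, add_zero]
  | succ m ih =>
    rw [thetaTail, ← add_assoc, add_right_comm, ih, thetaP_succ]
    simp only [mul_assoc]

/-- The class in `Ã_R / Ã_R P`, where `P = thetaP lam S n`, of the product of the linear factors
of `P` after the one of index `i + 1`. -/
noncomputable def tailClass (n i : ℕ) : Cyc R (thetaP lam S n) :=
  Submodule.Quotient.mk (thetaTail lam S i (n - i))

theorem tailClass_self (n : ℕ) : tailClass lam S n n = Submodule.Quotient.mk 1 := by
  rw [tailClass, Nat.sub_self, thetaTail]

theorem aAct_tailClass_zero (n : ℕ) :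
    Cyc.aAct (thetaP lam S n) (tailClass lam S n 0) = lamB R lam 1 • tailClass lam S n 0 := by
  rw [← sub_eq_zero, tailClass, Cyc.aAct_mk, Cyc.smul_mk, ← Submodule.Quotient.mk_sub, ← sub_mul,
    Submodule.Quotient.mk_eq_zero, ← thetaP_zero, ← thetaP_add, Nat.sub_zero, zero_add]
  exact Ideal.mem_span_singleton_self _

variable {S} in
theorem aAct_tailClass_succ (hS : ∀ j, constantCoeff (S j) = 1) {n i : ℕ} (h : i < n) :
    Cyc.aAct (thetaP lam S n) (tailClass lam S n (i + 1)) =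
      lamB R lam (i + 2) • tailClass lam S n (i + 1) + S (i + 1) • tailClass lam S n i := by
  obtain ⟨m, rfl⟩ := Nat.exists_eq_add_of_lt h
  rw [← sub_eq_iff_eq_add', tailClass, tailClass, Cyc.aAct_mk, Cyc.smul_mk, Cyc.smul_mk,
    ← Submodule.Quotient.mk_sub, ← sub_mul, show i + m + 1 - (i + 1) = m by omega,
    show i + m + 1 - i = m + 1 by omega, thetaTail, ← mul_assoc (ATilde.ofSeries R (S (i + 1))),
    ← map_mul, mul_invOfUnit _ 1 (by rw [hS, Units.val_one]), map_one, one_mul]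

variable {S} in
theorem map_thetaTail {R' : Type*} [CommRing R'] [Algebra ℂ R'] (g : R →ₐ[ℂ] R')
    {S' : ℕ → PowerSeries R'} (hS : ∀ j, constantCoeff (S j) = 1)
    (hSS' : ∀ j, PowerSeries.map (g : R →+* R') (S j) = S' j) (i m : ℕ) :
    ATilde.map (g : R →+* R') (thetaTail lam S i m) = thetaTail lam S' i m := by
  have map_lamB (j : ℕ) : PowerSeries.map (g : R →+* R') (lamB R lam j) = lamB R' lam j := by
    simp [lamB]
  induction m generalizing i with
  | zero => exact map_one _
  | succ m ih =>
    simp only [thetaTail, map_mul, map_sub, ATilde.map_a, ATilde.map_ofSeries, map_lamB, ih,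
      map_invOfUnit _ _ (hS _), hSS']

end Theta

section Chain

variable {R : Type*} [CommRing R] [Algebra ℂ R] {M : Type*} [AddCommGroup M]
  [Module (PowerSeries R) M]

/-- A sequence `e_0, …, e_n` in an `(a,b)`-module with `a e_0 = λ_1 b e_0` and
`a e_{i+1} = λ_{i+2} b e_{i+1} + S_{i+1} e_i`. -/
structure IsChain (aM : M → M) (lam : ℕ → ℚ) (S : ℕ → PowerSeries R) (n : ℕ) (e : ℕ → M) :
    Prop extends IsABOperator R aM where
  zero : aM (e 0) = lamB R lam 1 • e 0
  succ : ∀ i < n, aM (e (i + 1)) = lamB R lam (i + 2) • e (i + 1) + S (i + 1) • e i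

variable {aM : M → M} {lam : ℕ → ℚ} {S : ℕ → PowerSeries R} {n : ℕ} {e : ℕ → M}

theorem IsChain.map_mem_span (hc : IsChain aM lam S n e) (i : Fin (n + 1)) :
    aM (e i) ∈ Submodule.span (PowerSeries R) (Set.range fun i : Fin (n + 1) => e i) := by
  have mem_span (i : ℕ) (hi : i < n + 1) :
      e i ∈ Submodule.span (PowerSeries R) (Set.range fun i : Fin (n + 1) => e i) :=
    Submodule.subset_span ⟨⟨i, hi⟩, rfl⟩
  obtain ⟨i | i, hi⟩ := i
  · exact hc.zero ▸ Submodule.smul_mem _ _ (mem_span 0 hi)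
  · exact hc.succ i (by omega) ▸ Submodule.add_mem _ (Submodule.smul_mem _ _ (mem_span _ hi))
      (Submodule.smul_mem _ _ (mem_span i (by omega)))

section Universal

variable (hS : ∀ j, constantCoeff (S j) = 1)
include hS

variable (lam n) in
theorem isChain_tailClass :
    IsChain (Cyc.aAct (thetaP lam S n)) lam S n (tailClass lam S n) where
  toIsABOperator := Cyc.isABOperator_aAct _
  zero := aAct_tailClass_zero lam S n
  succ _ hi := aAct_tailClass_succ lam hS hi

variable (lam n) in
theorem span_tailClass :
    Submodule.span (PowerSeries R) (Set.range fun i : Fin (n + 1) => tailClass lam S n i) = ⊤ := by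
  rw [eq_top_iff, ← (Cyc.powBasis (isMonicModB_thetaP lam S n)).span_eq, Submodule.span_le]
  rintro _ ⟨i, rfl⟩
  rw [Cyc.powBasis_eq_iterate, ← tailClass_self]
  refine (Cyc.isABOperator_aAct _).iterate_mem_span ?_ (Set.mem_range_self (Fin.last n)) i
  rintro _ ⟨j, rfl⟩
  exact (isChain_tailClass lam n hS).map_mem_span j

variable (lam n) in
theorem linearIndependent_tailClass :
    LinearIndependent (PowerSeries R) fun i : Fin (n + 1) => tailClass lam S n i := by
  rcases subsingleton_or_nontrivial (PowerSeries R) with _ | _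
  · exact linearIndependent_of_subsingleton
  · refine linearIndependent_of_top_le_span_of_card_eq_finrank (span_tailClass lam n hS).ge ?_
    rw [Module.finrank_eq_card_basis (Cyc.powBasis (isMonicModB_thetaP lam S n))]

variable (lam n) in
/-- The basis of `Ã_R / Ã_R (thetaP lam S n)` formed by the classes of the right factors of
`thetaP lam S n`. -/
noncomputable def tailBasis : Module.Basis (Fin (n + 1)) (PowerSeries R) (Cyc R (thetaP lam S n)) :=
  Module.Basis.mk (linearIndependent_tailClass lam n hS) (span_tailClass lam n hS).ge

theorem tailBasis_apply (i : Fin (n + 1)) : tailBasis lam n hS i = tailClass lam S n i :=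
  Module.Basis.mk_apply _ _ i

omit hS in
variable (lam n) in
/-- The linear map from `Ã_R / Ã_R (thetaP lam S n)` that sends the classes of the right factors of
`thetaP lam S n` to `e_0, …, e_n`; it commutes with `a` when these form a chain. -/
noncomputable def chainMap (hS : ∀ j, constantCoeff (S j) = 1) (e : ℕ → M) :
    Cyc R (thetaP lam S n) →ₗ[PowerSeries R] M :=
  (tailBasis lam n hS).constr ℕ fun i => e i

theorem chainMap_tailClass {i : ℕ} (hi : i ≤ n) :
    chainMap lam n hS e (tailClass lam S n i) = e i := by
  have map_basis := (tailBasis lam n hS).constr_basis ℕ (fun i => e i) ⟨i, Nat.lt_succ_of_le hi⟩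
  rwa [tailBasis_apply] at map_basis

theorem chainMap_mk_one : chainMap lam n hS e (Submodule.Quotient.mk 1) = e n := by
  rw [← tailClass_self, chainMap_tailClass hS le_rfl]

theorem chainMap_injective (he : LinearIndependent (PowerSeries R) fun i : Fin (n + 1) => e i) :
    Function.Injective (chainMap lam n hS e) :=
  (tailBasis lam n hS).injective_constr_of_linearIndependent he

theorem chainMap_aAct (hc : IsChain aM lam S n e) (s : Cyc R (thetaP lam S n)) :
    chainMap lam n hS e (Cyc.aAct _ s) = aM (chainMap lam n hS e s) := by
  have hs : s ∈ Submodule.span (PowerSeries R)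
      (Set.range fun i : Fin (n + 1) => tailClass lam S n i) :=
    span_tailClass lam n hS ▸ Submodule.mem_top
  induction hs using Submodule.span_induction with
  | mem _ hx =>
    obtain ⟨⟨i | i, hi⟩, rfl⟩ := hx
    · simp only [aAct_tailClass_zero, map_smul]
      rw [chainMap_tailClass hS (by omega), hc.zero]
    · simp only [aAct_tailClass_succ lam hS (show i < n by omega), map_add, map_smul]
      rw [chainMap_tailClass hS (by omega), chainMap_tailClass hS (by omega),
        hc.succ i (by omega)]
  | zero => rw [map_zero, map_zero, hc.map_zero]
  | add x y _ _ hx hy => rw [map_add, map_add, hx, hy, map_add, hc.add]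
  | smul f x _ hx =>
    rw [(Cyc.isABOperator_aAct _).leibniz, map_add, map_smul, map_smul, hx, map_smul, hc.leibniz]

theorem chainMap_iterate (hc : IsChain aM lam S n e) (ν : ℕ) :
    chainMap lam n hS e ((Cyc.aAct _)^[ν] (Submodule.Quotient.mk 1)) = aM^[ν] (e n) := by
  rw [Function.Semiconj.iterate_right (chainMap_aAct hS hc) ν, chainMap_mk_one]

end Universal

namespace IsChain

variable (hc : IsChain aM lam S n e) (hS : ∀ j, constantCoeff (S j) = 1)
include hc hS

theorem span_iterate_fin :
    Submodule.span (PowerSeries R) (Set.range fun i : Fin (n + 1) => aM^[i] (e n)) =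
      LinearMap.range (chainMap lam n hS e) := by
  rw [LinearMap.range_eq_map, ← (Cyc.powBasis (isMonicModB_thetaP lam S n)).span_eq,
    Submodule.map_span, ← Set.range_comp]
  congr 2
  funext i
  rw [Function.comp_apply, Cyc.powBasis_eq_iterate, chainMap_iterate hS hc]

theorem span_iterate :
    Submodule.span (PowerSeries R) (Set.range fun ν : ℕ => aM^[ν] (e n)) =
      LinearMap.range (chainMap lam n hS e) := by
  refine le_antisymm (Submodule.span_le.2 ?_) ?_
  · rintro _ ⟨ν, rfl⟩
    exact ⟨_, chainMap_iterate hS hc ν⟩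
  · rw [← hc.span_iterate_fin hS]
    exact Submodule.span_mono (Set.range_comp_subset_range Fin.val fun ν => aM^[ν] (e n))

theorem linearIndependent_iterate
    (he : LinearIndependent (PowerSeries R) fun i : Fin (n + 1) => e i) :
    LinearIndependent (PowerSeries R) fun i : Fin (n + 1) => aM^[i] (e n) := by
  have map_powBasis := (Cyc.powBasis (isMonicModB_thetaP lam S n)).linearIndependent.map'
    (chainMap lam n hS e) (LinearMap.ker_eq_bot.2 (chainMap_injective hS he))
  simpa only [Function.comp_def, Cyc.powBasis_eq_iterate, chainMap_iterate hS hc] using map_powBasis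

end IsChain

end Chain

/-! ### Triangular chains of logarithmic solutions -/

section LogChain

variable {R : Type*} [CommRing R] [Algebra ℂ R]

/-- A solution `x` of `c x_j + x_{j+1} = y_j`, for a sequence `y` that vanishes beyond the index
`i`: the Neumann series of `c + shift` when `c ≠ 0`, and `y` moved by one place when `c = 0`. -/
noncomputable def shiftSolve (c : ℂ) (i : ℕ) (y : ℕ → R) (j : ℕ) : R :=
  if c = 0 then if j = 0 then 0 else y (j - 1)
  else -∑ t ∈ Finset.range (i + 1), (-c⁻¹) ^ (t + 1) • y (j + t)

theorem smul_shiftSolve_add {i : ℕ} {y : ℕ → R} (hy : ∀ j, i < j → y j = 0) (c : ℂ) (j : ℕ) :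
    c • shiftSolve c i y j + shiftSolve c i y (j + 1) = y j := by
  by_cases hc : c = 0
  · simp [shiftSolve, hc]
  have mul_neg_inv_pow (t : ℕ) : c * (-c⁻¹) ^ (t + 1) = -(-c⁻¹) ^ t := by
    rw [pow_succ', ← mul_assoc, mul_neg, mul_inv_cancel₀ hc, neg_one_mul]
  simp only [shiftSolve, hc, if_false, smul_neg, Finset.smul_sum, smul_smul, mul_neg_inv_pow,
    neg_smul, Finset.sum_neg_distrib, neg_neg, add_assoc j 1, add_comm 1]
  rw [← sub_eq_add_neg, ← Finset.sum_sub_distrib,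
    Finset.sum_range_sub' (fun t => (-c⁻¹) ^ t • y (j + t)), hy (j + (i + 1)) (by omega)]
  simp

theorem shiftSolve_eq_zero {i : ℕ} {y : ℕ → R} (hy : ∀ j, i < j → y j = 0) (c : ℂ) {j : ℕ}
    (hj : i + 1 < j) : shiftSolve c i y j = 0 := by
  rw [shiftSolve, hy (j - 1) (by omega),
    Finset.sum_eq_zero fun t _ => by rw [hy (j + t) (by omega), smul_zero]]
  simp

theorem shiftSolve_succ {i : ℕ} {y : ℕ → R} (hy : ∀ j, i < j → y j = 0) (c : ℂ) :
    shiftSolve c i y (i + 1) = if c = 0 then y i else 0 := by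
  rw [shiftSolve, Finset.sum_eq_zero fun t _ => by rw [hy (i + 1 + t) (by omega), smul_zero]]
  simp

theorem shiftSolve_zero (c : ℂ) (i j : ℕ) : shiftSolve c i (0 : ℕ → R) j = 0 := by
  simp [shiftSolve]

/-- The operator `a - λ b` on `⊕_j R[[b]] e_{λ,j}`, in terms of the coordinates `ψ_j` on the
`e_{λ,j}`; it does not depend on `λ`. -/
noncomputable def logA (ψ : ℕ → PowerSeries R) (j : ℕ) : PowerSeries R :=
  X ^ 2 * derivative R (ψ j) + X * ψ (j + 1)

omit [Algebra ℂ R] in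
theorem coeff_zero_logA (ψ : ℕ → PowerSeries R) (j : ℕ) : coeff 0 (logA ψ j) = 0 := by
  simp [logA]

omit [Algebra ℂ R] in
theorem coeff_succ_logA (ψ : ℕ → PowerSeries R) (j n : ℕ) :
    coeff (n + 1) (logA ψ j) = n * coeff n (ψ j) + coeff n (ψ (j + 1)) := by
  rw [logA, map_add, pow_two, mul_assoc, coeff_succ_X_mul, coeff_succ_X_mul]
  rcases n with - | n
  · simp
  · rw [coeff_succ_X_mul, coeff_derivative, Nat.cast_succ, mul_comm]

/-- A solution `ψ` of `(a - (λ + d) b) ψ = η` in `⊕_j R[[b]] e_{λ,j}`, for `η ∈ b R[[b]]` whose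
coordinates vanish beyond the index `i`. -/
noncomputable def logSolve (d i : ℕ) (η : ℕ → PowerSeries R) (j : ℕ) : PowerSeries R :=
  PowerSeries.mk fun n => shiftSolve ((n : ℂ) - d) i (fun j => coeff (n + 1) (η j)) j

section LogSolve

variable {i : ℕ} {η : ℕ → PowerSeries R} (hη : ∀ j, i < j → η j = 0) (d : ℕ)
include hη

theorem logA_logSolve (hη0 : ∀ j, coeff 0 (η j) = 0) (j : ℕ) :
    logA (logSolve d i η) j = ((d : PowerSeries R) * X) * logSolve d i η j + η j := by
  ext n
  rcases n with - | n
  · rw [coeff_zero_logA, map_add, hη0, mul_right_comm, coeff_zero_mul_X, add_zero]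
  have solve := smul_shiftSolve_add (y := fun j => coeff (n + 1) (η j))
    (fun j hj => by rw [hη j hj, map_zero]) ((n : ℂ) - d) j
  rw [coeff_succ_logA, map_add, ← map_natCast C, mul_assoc, coeff_C_mul, coeff_succ_X_mul]
  simp only [logSolve, coeff_mk]
  rw [← solve, Algebra.smul_def, map_sub, map_natCast, map_natCast]
  ring

theorem logSolve_eq_zero {j : ℕ} (hj : i + 1 < j) : logSolve d i η j = 0 := by
  ext n
  exact (coeff_mk _ _).trans
    (shiftSolve_eq_zero (fun j hj => by rw [hη j hj, map_zero]) _ hj)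

theorem logSolve_succ :
    logSolve d i η (i + 1) = C (coeff (d + 1) (η i)) * X ^ d := by
  ext n
  rw [logSolve, coeff_mk, shiftSolve_succ (fun j hj => by rw [hη j hj, map_zero]), coeff_C_mul,
    coeff_X_pow, mul_ite, mul_one, mul_zero]
  simp only [sub_eq_zero, Nat.cast_inj]
  split_ifs with hn
  · rw [hn]
  · rfl

omit hη in
theorem X_pow_dvd_logSolve {m : ℕ} (hdvd : ∀ j, X ^ m ∣ η j) (j : ℕ) :
    X ^ (m - 1) ∣ logSolve d i η j := by
  refine X_pow_dvd_iff.2 fun n hn => ?_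
  have coeff_eq_zero : (fun j => coeff (n + 1) (η j)) = 0 :=
    funext fun j => X_pow_dvd_iff.1 (hdvd j) (n + 1) (by omega)
  rw [logSolve, coeff_mk, coeff_eq_zero, shiftSolve_zero]

end LogSolve

/-- Elements `ψ_0 = b ^ {d_0} e_{λ,0}, ψ_1, …` of `⊕_j R[[b]] e_{λ,j}`, in terms of their
coordinates, with `(a - (λ + d_{i+1}) b) ψ_{i+1} = S_{i+1} ψ_i`. -/
noncomputable def logChain (d : ℕ → ℕ) (S : ℕ → PowerSeries R) : ℕ → ℕ → PowerSeries R
  | 0 => Pi.single 0 (X ^ d 0)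
  | i + 1 => logSolve (d (i + 1)) i (S (i + 1) • logChain d S i)

variable (d : ℕ → ℕ) (S : ℕ → PowerSeries R)

theorem logChain_eq_zero {i j : ℕ} (h : i < j) : logChain d S i j = 0 := by
  induction i generalizing j with
  | zero => exact Pi.single_eq_of_ne h.ne' _
  | succ i ih =>
    exact logSolve_eq_zero (fun j hj => by rw [Pi.smul_apply, ih hj, smul_zero]) _ h

theorem smul_logChain_eq_zero {i j : ℕ} (h : i < j) : (S (i + 1) • logChain d S i) j = 0 := by
  rw [Pi.smul_apply, logChain_eq_zero d S h, smul_zero]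

theorem X_pow_dvd_logChain (i j : ℕ) : X ^ (d 0 - i) ∣ logChain d S i j := by
  induction i generalizing j with
  | zero =>
    rw [logChain, Pi.single_apply]
    split_ifs
    exacts [dvd_rfl, dvd_zero _]
  | succ i ih => exact X_pow_dvd_logSolve _ (fun j => (ih j).mul_left _) j

theorem logA_logChain_zero (j : ℕ) :
    logA (logChain d S 0) j = ((d 0 : PowerSeries R) * X) * logChain d S 0 j := by
  rw [logA, logChain_eq_zero d S j.succ_pos, mul_zero, add_zero, logChain, Pi.single_apply]
  split_ifs
  · rcases d 0 with - | m
    · simp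
    · simp
      ring
  · simp

theorem logA_logChain_succ {i : ℕ} (h : i < d 0) (j : ℕ) :
    logA (logChain d S (i + 1)) j =
      ((d (i + 1) : PowerSeries R) * X) * logChain d S (i + 1) j + S (i + 1) * logChain d S i j :=
  logA_logSolve (fun _ => smul_logChain_eq_zero d S) _ (fun j => X_pow_dvd_iff.1
    ((X_pow_dvd_logChain d S i j).mul_left _) 0 (by omega)) j

variable {d} in
theorem logChain_self {p : ℕ → ℕ} {n : ℕ} (hd : ∀ i < n, d (i + 1) + 1 = d i + p (i + 1)) {i : ℕ}
    (hi : i ≤ n) :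
    logChain d S i i = C (∏ t ∈ Finset.range i, coeff (p (t + 1)) (S (t + 1))) * X ^ d i := by
  induction i with
  | zero => simp [logChain]
  | succ i ih =>
    rw [logChain, logSolve_succ (fun _ => smul_logChain_eq_zero d S), hd i hi, Pi.smul_apply,
      ih (by omega), smul_eq_mul, ← mul_assoc, add_comm (d i), coeff_mul_X_pow, coeff_mul_C,
      Finset.prod_range_succ, mul_comm (coeff _ _)]

end LogChain

section XiChain

theorem Xi.map_smul {R R' : Type*} [CommRing R] [CommRing R'] {Λ : Finset ℚ} {N : ℕ}
    (g : R →+* R') (f : PowerSeries R) (v : Xi R Λ N) :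
    Xi.map g (f • v) = PowerSeries.map g f • Xi.map g v :=
  funext fun i => map_mul (PowerSeries.map g) f (v i)

theorem Xi.map_add {R R' : Type*} [CommRing R] [CommRing R'] {Λ : Finset ℚ} {N : ℕ}
    (g : R →+* R') (v w : Xi R Λ N) : Xi.map g (v + w) = Xi.map g v + Xi.map g w :=
  funext fun i => _root_.map_add (PowerSeries.map g) (v i) (w i)

theorem Xi.map_zero {R R' : Type*} [CommRing R] [CommRing R'] {Λ : Finset ℚ} {N : ℕ}
    (g : R →+* R') : Xi.map g (0 : Xi R Λ N) = 0 :=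
  funext fun _ => _root_.map_zero (PowerSeries.map g)

variable {R : Type*} [CommRing R] [Algebra ℂ R]

/-- A chain in `Ξ_λ^{(n)}` that is triangular with respect to the basis `e_{λ,j}`, with diagonal
coordinates `c_i b ^ {d_i}`. -/
structure IsTriangularChain (lam : ℕ → ℚ) (S : ℕ → PowerSeries R) (n : ℕ) {l : ℚ} (c : ℕ → R)
    (d : ℕ → ℕ) (e : ℕ → Xi R {l} n) : Prop extends IsChain Xi.aMap lam S n e where
  upper : ∀ i ≤ n, ∀ j, i < (j.2 : ℕ) → e i j = 0
  diag : ∀ i ≤ n, ∀ j, (j.2 : ℕ) = i → e i j = C (c i) * X ^ d i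

theorem Xi.aMap_comp_snd {l : ℚ} {n : ℕ} {ψ : ℕ → PowerSeries R} (hψ : ∀ j, n < j → ψ j = 0)
    (j : ({l} : Finset ℚ) × Fin (n + 1)) :
    Xi.aMap (fun j : ({l} : Finset ℚ) × Fin (n + 1) => ψ j.2) j =
      C (algebraMap ℂ R l) * X * ψ j.2 + logA ψ j.2 := by
  obtain ⟨⟨q, hq⟩, j⟩ := j
  obtain rfl := Finset.mem_singleton.mp hq
  have dite_eq : (if h : (j : ℕ) + 1 < n + 1 then ψ (j + 1) else 0) = ψ (j + 1) := by
    split_ifs with h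
    exacts [rfl, (hψ _ (by omega)).symm]
  simp only [Xi.aMap, logA]
  rw [dite_eq]
  ring

theorem isTriangularChain_logChain {lam : ℕ → ℚ} {n : ℕ} {l : ℚ} {p d : ℕ → ℕ}
    (hd : ∀ i < n, d (i + 1) + 1 = d i + p (i + 1)) (hd0 : n ≤ d 0)
    (hlam : ∀ i ≤ n, lam (i + 1) = l + d i) (S : ℕ → PowerSeries R) :
    IsTriangularChain lam S n (l := l)
      (fun i => ∏ t ∈ Finset.range i, coeff (p (t + 1)) (S (t + 1))) d
      fun i j => logChain d S i j.2 := by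
  have lamB_succ (i : ℕ) (hi : i ≤ n) :
      lamB R lam (i + 1) = C (algebraMap ℂ R l) * X + (d i : PowerSeries R) * X := by
    simp [lamB, hlam i hi, add_mul]
  have vanish (i : ℕ) (hi : i ≤ n) (j : ℕ) (hj : n < j) : logChain d S i j = 0 :=
    logChain_eq_zero d S (hi.trans_lt hj)
  refine ⟨⟨Xi.isABOperator_aMap, funext fun j => ?_, fun i hi => funext fun j => ?_⟩,
    fun i _ j hj => logChain_eq_zero d S hj, ?_⟩
  · rw [Xi.aMap_comp_snd (vanish 0 n.zero_le), logA_logChain_zero, Pi.smul_apply, smul_eq_mul,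
      lamB_succ 0 n.zero_le, add_mul]
  · rw [Xi.aMap_comp_snd (vanish (i + 1) hi), logA_logChain_succ d S (hi.trans_le hd0),
      Pi.add_apply, Pi.smul_apply, Pi.smul_apply, smul_eq_mul, smul_eq_mul, lamB_succ (i + 1) hi,
      add_mul, add_assoc]
  · rintro i hi j rfl
    exact logChain_self S hd hi

namespace IsTriangularChain

variable {lam : ℕ → ℚ} {S : ℕ → PowerSeries R} {n : ℕ} {l : ℚ} {c : ℕ → R} {d : ℕ → ℕ}
  {e : ℕ → Xi R {l} n} (he : IsTriangularChain lam S n c d e)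
include he

theorem map {R' : Type*} [CommRing R'] [Algebra ℂ R'] (g : R →ₐ[ℂ] R') :
    IsTriangularChain lam (fun j => PowerSeries.map (g : R →+* R') (S j)) n (fun i => g (c i)) d
      (fun i => Xi.map (g : R →+* R') (e i)) where
  toIsABOperator := Xi.isABOperator_aMap
  zero := by rw [← Xi.map_aMap, he.zero, Xi.map_smul]; simp [lamB]
  succ i hi := by
    rw [← Xi.map_aMap, he.succ i hi, Xi.map_add, Xi.map_smul, Xi.map_smul]
    simp [lamB]
  upper i hi j hj := by simp [Xi.map, he.upper i hi j hj]
  diag i hi j hj := by simp [Xi.map, he.diag i hi j hj]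

theorem linearIndependent (hc : ∀ i ≤ n, c i ∈ nonZeroDivisors R) :
    LinearIndependent (PowerSeries R) fun i : Fin (n + 1) => e i := by
  rw [Fintype.linearIndependent_iff]
  intro f hf i
  induction i using WellFoundedGT.induction with
  | ind i ih =>
    have mul_diag : f i * (C (c i) * X ^ d i) = 0 := by
      have at_i := congrFun hf (⟨l, Finset.mem_singleton_self l⟩, i)
      rw [Finset.sum_apply, Finset.sum_eq_single i] at at_i
      · rwa [Pi.smul_apply, he.diag i i.is_le _ rfl] at at_i
      · intro j _ hj
        rcases hj.lt_or_gt with hj | hj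
        · rw [Pi.smul_apply, he.upper j j.is_le _ hj, smul_zero]
        · rw [ih j hj, zero_smul, Pi.zero_apply]
      · simp
    ext m
    refine (mem_nonZeroDivisors_iff.1 (hc i i.is_le)).2 _ ?_
    simpa only [← mul_assoc, coeff_mul_X_pow, coeff_mul_C, map_zero] using
      congrArg (coeff (m + d i)) mul_diag

end IsTriangularChain

end XiChain

/-! ### Gluing of sections -/

section BaseChange

variable {R R' : Type*} [CommRing R] [CommRing R'] (g : R →+* R')

namespace Cyc

variable {P : ATilde R} {P' : ATilde R'}

theorem map_id (h : ATilde.map (RingHom.id R) P = P) (s : Cyc R P) :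
    Cyc.map (RingHom.id R) h s = s := by
  obtain ⟨u, rfl⟩ := Submodule.Quotient.mk_surjective _ s
  rw [map_mk]
  congr 1
  ext : 3
  simp [ATilde.map]

theorem map_map {R'' : Type*} [CommRing R''] (g' : R' →+* R'') {P'' : ATilde R''}
    (h : ATilde.map g P = P') (h' : ATilde.map g' P' = P'')
    (h'' : ATilde.map (g'.comp g) P = P'') (s : Cyc R P) :
    Cyc.map g' h' (Cyc.map g h s) = Cyc.map (g'.comp g) h'' s := by
  obtain ⟨u, rfl⟩ := Submodule.Quotient.mk_surjective _ s
  rw [map_mk, map_mk, map_mk]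
  congr 1
  ext
  simp [ATilde.map]

variable {g} (h : ATilde.map g P = P')

theorem map_surjective (hg : Function.Surjective g) : Function.Surjective (Cyc.map g h) := by
  intro t
  obtain ⟨u, rfl⟩ := Submodule.Quotient.mk_surjective _ t
  obtain ⟨v, hv⟩ := PowerSeries.map_surjective (Polynomial.mapRingHom g)
    (Polynomial.map_surjective g hg) u.series
  refine ⟨Submodule.Quotient.mk ⟨v⟩, ?_⟩
  rw [map_mk]
  exact congrArg Submodule.Quotient.mk (ATilde.ext hv)

theorem map_eq_zero_iff {k : ℕ} (hP : P.IsMonicModB k) (s : Cyc R P) :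
    Cyc.map g h s = 0 ↔
      s ∈ RingHom.ker (PowerSeries.map g) • (⊤ : Submodule (PowerSeries R) (Cyc R P)) := by
  refine ⟨fun hs => ?_, fun hs => ?_⟩
  · rw [← (powBasis hP).sum_repr s]
    refine Submodule.sum_mem _ fun i _ => Submodule.smul_mem_smul ?_ trivial
    rw [RingHom.mem_ker, ← powBasis_repr_map g h hP (h ▸ hP.map g), hs, map_zero,
      Finsupp.zero_apply]
  · induction hs using Submodule.smul_induction_on' with
    | smul f hf t _ => rw [map_smul, RingHom.mem_ker.mp hf, zero_smul]
    | add s _ t _ hs ht => rw [map_add, hs, ht, add_zero]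

end Cyc

variable [Algebra ℂ R] [Algebra ℂ R'] {lam : ℕ → ℚ} {S : ℕ → PowerSeries R}
  {S' : ℕ → PowerSeries R'}

theorem Cyc.map_tailClass (g : R →ₐ[ℂ] R') (hS : ∀ j, constantCoeff (S j) = 1)
    (hSS' : ∀ j, PowerSeries.map (g : R →+* R') (S j) = S' j) {n : ℕ}
    (h : ATilde.map (g : R →+* R') (thetaP lam S n) = thetaP lam S' n) (i : ℕ) :
    Cyc.map (g : R →+* R') h (tailClass lam S n i) = tailClass lam S' n i := by
  rw [tailClass, map_mk, map_thetaTail lam g hS hSS', tailClass]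

theorem chainMap_map (g : R →ₐ[ℂ] R') (hS : ∀ j, constantCoeff (S j) = 1)
    (hS' : ∀ j, constantCoeff (S' j) = 1)
    (hSS' : ∀ j, PowerSeries.map (g : R →+* R') (S j) = S' j) {n : ℕ}
    (h : ATilde.map (g : R →+* R') (thetaP lam S n) = thetaP lam S' n) {Λ : Finset ℚ} {N : ℕ}
    (e : ℕ → Xi R Λ N) (s : Cyc R (thetaP lam S n)) :
    chainMap lam n hS' (fun i => Xi.map (g : R →+* R') (e i)) (Cyc.map (g : R →+* R') h s) =
      Xi.map (g : R →+* R') (chainMap lam n hS e s) := by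
  have hs : s ∈ Submodule.span (PowerSeries R)
      (Set.range fun i : Fin (n + 1) => tailClass lam S n i) :=
    span_tailClass lam n hS ▸ Submodule.mem_top
  induction hs using Submodule.span_induction with
  | mem _ hx =>
    obtain ⟨i, rfl⟩ := hx
    rw [Cyc.map_tailClass g hS hSS', chainMap_tailClass hS' i.is_le, chainMap_tailClass hS i.is_le]
  | zero => rw [map_zero, map_zero, map_zero, Xi.map_zero]
  | add x y _ _ hx hy => rw [map_add, map_add, hx, hy, map_add, Xi.map_add]
  | smul f x _ hx => rw [Cyc.map_smul, map_smul, hx, map_smul, Xi.map_smul]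

end BaseChange

section Hol

variable {E X : Type*} [NormedAddCommGroup E] [NormedSpace ℂ E] [TopologicalSpace X]
  [ChartedSpace E X]

namespace Hol

theorem res_apply {V W : Opens X} (h : W ≤ V) (f : Hol E V) (x : W) :
    Hol.res E h f x = f ⟨x, h x.2⟩ := rfl

theorem mem_nonZeroDivisors {V : Opens X} {f : Hol E V} (hf : ∀ x, f x ≠ 0) :
    f ∈ nonZeroDivisors (Hol E V) := by
  refine mem_nonZeroDivisors_iff_right.mpr fun r hr => ContMDiffMap.ext fun x => ?_
  exact (mul_eq_zero.mp (DFunLike.congr_fun hr x)).resolve_right (hf x)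

theorem exists_glue {I : Type*} (U : I → Opens X) (f : ∀ i, Hol E (U i))
    (hf : ∀ i j, Hol.res E (inf_le_left : U i ⊓ U j ≤ U i) (f i) =
      Hol.res E (inf_le_right : U i ⊓ U j ≤ U j) (f j)) :
    ∃ g : Hol E (iSup U), ∀ i, Hol.res E (le_iSup U i) g = f i := by
  classical
  let G (y : X) : ℂ := if h : ∃ i, y ∈ U i then f h.choose ⟨y, h.choose_spec⟩ else 0
  have G_eq (i : I) (y : U i) : G y = f i y := by
    have hy : ∃ i, (y : X) ∈ U i := ⟨i, y.2⟩
    exact (dif_pos hy).trans (DFunLike.congr_fun (hf hy.choose i) ⟨y, hy.choose_spec, y.2⟩)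
  refine ⟨⟨fun x => G x, fun x => ?_⟩, fun i => ContMDiffMap.ext (G_eq i)⟩
  obtain ⟨i, hi⟩ := Opens.mem_iSup.mp x.2
  have contMDiffAt_G : ContMDiffAt 𝓘(ℂ, E) 𝓘(ℂ, ℂ) ω (fun y : U i => G y) ⟨x, hi⟩ := by
    simpa only [G_eq] using (f i).contMDiff _
  exact contMDiffAt_subtype_iff.2 ((contMDiffAt_subtype_iff (x := (⟨x, hi⟩ : U i))).1 contMDiffAt_G)

end Hol

namespace HolB

theorem coeff_res {V W : Opens X} (h : W ≤ V) (f : HolB E V) (n : ℕ) :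
    coeff n (HolB.res h f) = Hol.res E h (coeff n f) :=
  coeff_map _ _ _

theorem res_self {V : Opens X} (f : HolB E V) : HolB.res (le_refl V) f = f := by
  ext n x
  rw [coeff_res, Hol.res_apply]

theorem res_res {U V W : Opens X} (h : V ≤ U) (h' : W ≤ V) (f : HolB E U) :
    HolB.res h' (HolB.res h f) = HolB.res (h'.trans h) f := by
  ext n x
  simp only [coeff_res, Hol.res_apply]

theorem eq_of_locally_eq {V : Opens X} {f g : HolB E V}
    (hfg : ∀ x ∈ V, ∃ (W : Opens X) (h : W ≤ V), x ∈ W ∧ HolB.res h f = HolB.res h g) :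
    f = g := by
  ext n x
  obtain ⟨W, h, hx, res_eq⟩ := hfg x x.2
  simpa only [coeff_res, Hol.res_apply] using
    congrArg (fun u : HolB E W => coeff n u ⟨x, hx⟩) res_eq

theorem exists_glue {I : Type*} (U : I → Opens X) (f : ∀ i, HolB E (U i))
    (hf : ∀ i j, HolB.res (inf_le_left : U i ⊓ U j ≤ U i) (f i) =
      HolB.res (inf_le_right : U i ⊓ U j ≤ U j) (f j)) :
    ∃ g : HolB E (iSup U), ∀ i, HolB.res (le_iSup U i) g = f i := by
  have glue_coeff (n : ℕ) : ∃ g : Hol E (iSup U), ∀ i,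
      Hol.res E (le_iSup U i) g = coeff n (f i) :=
    Hol.exists_glue U _ fun i j => by rw [← coeff_res, hf, coeff_res]
  choose g hg using glue_coeff
  refine ⟨PowerSeries.mk g, fun i => PowerSeries.ext fun n => ?_⟩
  rw [coeff_res, coeff_mk, hg]

end HolB

namespace Xi

variable {Λ : Finset ℚ} {N : ℕ} {U V W : Opens X}

theorem res_self (v : Xi (Hol E V) Λ N) : Xi.res (le_refl V) v = v :=
  funext fun i => HolB.res_self (v i)

theorem res_res (h : V ≤ U) (h' : W ≤ V) (v : Xi (Hol E U) Λ N) :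
    Xi.res h' (Xi.res h v) = Xi.res (h'.trans h) v :=
  funext fun i => HolB.res_res h h' (v i)

theorem eq_of_locally_eq {v w : Xi (Hol E V) Λ N}
    (hvw : ∀ x ∈ V, ∃ (W : Opens X) (h : W ≤ V), x ∈ W ∧ Xi.res h v = Xi.res h w) : v = w :=
  funext fun i => HolB.eq_of_locally_eq fun x hx => by
    obtain ⟨W, h, hxW, res_eq⟩ := hvw x hx
    exact ⟨W, h, hxW, congrFun res_eq i⟩

end Xi

end Hol

section Gluing

variable {E X : Type*} [NormedAddCommGroup E] [NormedSpace ℂ E] [TopologicalSpace X]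
  [ChartedSpace E X] {P : ∀ V : Opens X, ATilde (Hol E V)}
  (hres : ∀ {V W : Opens X} (h : W ≤ V),
    ATilde.map (Hol.res E h : Hol E V →+* Hol E W) (P V) = P W)
  {k : ℕ} (hP : ∀ V, (P V).IsMonicModB k)
include hP

namespace Cyc

theorem eq_of_locally_eq {V : Opens X} {s t : Cyc (Hol E V) (P V)}
    (hst : ∀ x ∈ V, ∃ (W : Opens X) (h : W ≤ V), x ∈ W ∧
      Cyc.map _ (hres h) s = Cyc.map _ (hres h) t) : s = t := by
  refine (powBasis (hP V)).ext_elem fun i => HolB.eq_of_locally_eq fun x hx => ?_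
  obtain ⟨W, h, hxW, res_eq⟩ := hst x hx
  have res_repr (u : Cyc (Hol E V) (P V)) := powBasis_repr_map _ (hres h) (hP V) (hP W) u i
  exact ⟨W, h, hxW, (res_repr s).symm.trans ((congrArg (fun u => (powBasis (hP W)).repr u i)
    res_eq).trans (res_repr t))⟩

theorem exists_glue {I : Type*} (U : I → Opens X) (s : ∀ i, Cyc (Hol E (U i)) (P (U i)))
    (hs : ∀ i j, Cyc.map _ (hres (inf_le_left : U i ⊓ U j ≤ U i)) (s i) =
      Cyc.map _ (hres (inf_le_right : U i ⊓ U j ≤ U j)) (s j)) :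
    ∃ t : Cyc (Hol E (iSup U)) (P (iSup U)), ∀ i, Cyc.map _ (hres (le_iSup U i)) t = s i := by
  have res_repr (m : Fin k) {V W : Opens X} (h : W ≤ V) (u : Cyc (Hol E V) (P V)) :
      HolB.res h ((powBasis (hP V)).repr u m) =
        (powBasis (hP W)).repr (Cyc.map _ (hres h) u) m :=
    (powBasis_repr_map _ (hres h) (hP V) (hP W) u m).symm
  have glue_coordinate (m : Fin k) : ∃ g : HolB E (iSup U), ∀ i,
      HolB.res (le_iSup U i) g = (powBasis (hP (U i))).repr (s i) m :=
    HolB.exists_glue U _ fun i j => by rw [res_repr, res_repr, hs]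
  choose g hg using glue_coordinate
  refine ⟨(powBasis (hP (iSup U))).equivFun.symm g, fun i =>
    (powBasis (hP (U i))).ext_elem fun m => ?_⟩
  rw [← res_repr, ← hg, ← Module.Basis.equivFun_apply, LinearEquiv.apply_symm_apply]

end Cyc

-- Injectivity makes the local preimages of a section agree on overlaps, so that they glue.
theorem range_eq_genSheaf {U : Opens X} {Λ : Finset ℚ} {N : ℕ} {φ : Xi (Hol E U) Λ N}
    (θ : ∀ {V : Opens X}, V ≤ U → (Cyc (Hol E V) (P V) →ₗ[HolB E V] Xi (Hol E V) Λ N))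
    (θ_injective : ∀ {V : Opens X} (hV : V ≤ U), Function.Injective (θ hV))
    (θ_res : ∀ {V W : Opens X} (hV : V ≤ U) (h : W ≤ V) (s : Cyc (Hol E V) (P V)),
      θ (h.trans hV) (Cyc.map _ (hres h) s) = Xi.res h (θ hV s))
    (range_θ : ∀ {V : Opens X} (hV : V ≤ U),
      LinearMap.range (θ hV) = Xi.orbitSpan (Xi.res hV φ))
    {V : Opens X} (hV : V ≤ U) : LinearMap.range (θ hV) = genSheaf φ V hV := by
  refine le_antisymm (fun s hs => ?_) (fun s hs => ?_)
  · refine fun x hx => ⟨V, le_rfl, hx, ?_⟩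
    rw [Xi.res_self]
    exact (range_θ hV).le hs
  · have exists_local (x : V) : ∃ (W : Opens X) (h : W ≤ V), (x : X) ∈ W ∧
        ∃ t, θ (h.trans hV) t = Xi.res h s := by
      obtain ⟨W, h, hxW, mem⟩ := hs x x.2
      exact ⟨W, h, hxW, (range_θ (h.trans hV)).ge mem⟩
    choose W hWV hxW t ht using exists_local
    obtain ⟨u, hu⟩ := Cyc.exists_glue hres hP W t fun x y => θ_injective
      (inf_le_left.trans ((hWV x).trans hV)) <| by
        rw [θ_res ((hWV x).trans hV), θ_res ((hWV y).trans hV), ht, ht, Xi.res_res, Xi.res_res]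
    have hV_le : V ≤ iSup W := fun x hx => Opens.mem_iSup.2 ⟨⟨x, hx⟩, hxW _⟩
    refine ⟨Cyc.map _ (hres hV_le) u, Xi.eq_of_locally_eq fun x hx =>
      ⟨W ⟨x, hx⟩, hWV _, hxW ⟨x, hx⟩, ?_⟩⟩
    rw [← θ_res hV, ← ht, ← hu]
    exact congrArg (θ _) (Cyc.map_map _ _ (hres hV_le) (hres _) (hres (le_iSup W _)) u)

end Gluing

section CyclicFamily

variable {E X : Type} [NormedAddCommGroup E] [NormedSpace ℂ E] [TopologicalSpace X]
  [ChartedSpace E X]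

/-- The presheaf `V ↦ Ã_{𝒪(V)} / Ã_{𝒪(V)} P` on a complex manifold, for an element `P` of `Ã` with
holomorphic coefficients, given by its restrictions `P V` to the open sets. -/
noncomputable def cyclicFamily (P : ∀ V : Opens X, ATilde (Hol E V))
    (hres : ∀ {V W : Opens X} (h : W ≤ V),
      ATilde.map (Hol.res E h : Hol E V →+* Hol E W) (P V) = P W) : ABPresheaf E X where
  obj V := Cyc (Hol E V) (P V)
  aMap V := Cyc.aAct (P V)
  res h := Cyc.map _ (hres h)

variable {P : ∀ V : Opens X, ATilde (Hol E V)}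
  (hres : ∀ {V W : Opens X} (h : W ≤ V),
    ATilde.map (Hol.res E h : Hol E V →+* Hol E W) (P V) = P W)
  {k : ℕ} (hP : ∀ V, (P V).IsMonicModB k)
include hP

theorem isABSheaf_cyclicFamily : IsABSheaf (cyclicFamily P hres) where
  res_self _ := Cyc.map_id (hres le_rfl)
  res_res h h' := Cyc.map_map _ _ (hres h) (hres h') (hres (h'.trans h))
  res_smul h := Cyc.map_smul _ (hres h)
  separated _ _ _ := Cyc.eq_of_locally_eq hres hP
  glue := Cyc.exists_glue hres hP
  locally_free x := by
    refine ⟨⊤, k, Cyc.powBasis (hP ⊤), trivial, fun V h => ?_⟩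
    have res_powBasis : (fun i => (cyclicFamily P hres).res h (Cyc.powBasis (hP ⊤) i)) =
        Cyc.powBasis (hP V) :=
      funext (Cyc.map_powBasis _ (hres h) (hP ⊤) (hP V))
    rw [res_powBasis]
    exact ⟨(Cyc.powBasis (hP V)).linearIndependent, (Cyc.powBasis (hP V)).span_eq⟩
  res_aMap h := Cyc.map_aAct _ (hres h)
  aMap_C_smul V := (Cyc.isABOperator_aAct (P V)).map_C_smul
  aMap_continuous V n := ⟨n, (Cyc.isABOperator_aAct (P V)).exists_map_X_pow_smul n⟩
  aMap_b V := (Cyc.isABOperator_aAct (P V)).map_X_smul_sub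

theorem isFibre_cyclicFamily (x : X) {Q : ATilde ℂ}
    (hQ : ∀ (V : Opens X) (hx : x ∈ V),
      ATilde.map (Hol.eval E (⟨x, hx⟩ : V) : Hol E V →+* ℂ) (P V) = Q) :
    IsFibre (cyclicFamily P hres) x (Cyc ℂ Q) (Cyc.aAct Q) := by
  have eval_surjective : Function.Surjective (Hol.eval E (⟨x, trivial⟩ : (⊤ : Opens X))) :=
    fun c => ⟨algebraMap ℂ _ c, rfl⟩
  have eval_res {V W : Opens X} (h : W ≤ V) (hx : x ∈ W) (s : Cyc (Hol E V) (P V)) :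
      Cyc.map _ (hQ W hx) (Cyc.map _ (hres h) s) = Cyc.map _ (hQ V (h hx)) s :=
    Cyc.map_map _ _ (hres h) (hQ W hx) (hQ V (h hx)) s
  refine ⟨fun V hx => Cyc.map _ (hQ V hx), fun V W => eval_res,
    fun V hx => Cyc.map_smul _ (hQ V hx), fun V hx => Cyc.map_aAct _ (hQ V hx),
    fun m => ⟨⊤, trivial, Cyc.map_surjective (hQ ⊤ trivial) eval_surjective m⟩,
    fun V hx s => ⟨fun hs => ⟨V, le_rfl, hx, ?_⟩, ?_⟩⟩
  · rw [(isABSheaf_cyclicFamily hres hP).res_self]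
    exact (Cyc.map_eq_zero_iff (hQ V hx) (hP V) s).1 hs
  · rintro ⟨W, h, hxW, mem⟩
    exact (eval_res h hxW s).symm.trans ((Cyc.map_eq_zero_iff (hQ W hxW) (hP W) _).2 mem)

end CyclicFamily

/-! ### Embedding into `Ξ` -/

section Exponents

theorem exists_natCast_shift {n : ℕ} {lam : ℕ → ℚ} {p : ℕ → ℕ} (hlam1 : (n : ℚ) < lam 1)
    (hlam : ∀ i < n, lam (i + 2) = lam (i + 1) + p (i + 1) - 1) :
    ∃ (l : ℚ) (d : ℕ → ℕ), 0 < l ∧ l ≤ 1 ∧ n ≤ d 0 ∧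
      (∀ i < n, d (i + 1) + 1 = d i + p (i + 1)) ∧ ∀ i ≤ n, lam (i + 1) = l + d i := by
  obtain ⟨m, hm⟩ : ∃ m : ℕ, (m : ℤ) = ⌈lam 1⌉ - 1 :=
    ⟨(⌈lam 1⌉ - 1).toNat, Int.toNat_of_nonneg (by
      have := Int.ceil_pos.2 (n.cast_nonneg.trans_lt hlam1); omega)⟩
  have n_le_m : n ≤ m := by
    have : (n : ℤ) < ⌈lam 1⌉ := Int.lt_ceil.2 (mod_cast hlam1)
    omega
  have m_cast : (m : ℚ) = ⌈lam 1⌉ - 1 := mod_cast hm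
  have exists_d (i : ℕ) (hi : i ≤ n) : ∃ d : ℕ, n ≤ d + i ∧ lam (i + 1) = lam 1 - m + d := by
    induction i with
    | zero => exact ⟨m, n_le_m, by ring⟩
    | succ i ih =>
      obtain ⟨d, n_le, lam_eq⟩ := ih (by omega)
      refine ⟨d + p (i + 1) - 1, by omega, ?_⟩
      rw [hlam i hi, lam_eq, Nat.cast_sub (by omega)]
      push_cast
      ring
  choose! d hd using exists_d
  refine ⟨lam 1 - m, d, ?_, ?_, (hd 0 n.zero_le).1, fun i hi => ?_, fun i hi => (hd i hi).2⟩
  · linarith [Int.ceil_lt_add_one (lam 1)]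
  · linarith [Int.le_ceil (lam 1)]
  · have lam_eq := hlam i hi
    rw [(hd (i + 1) hi).2, (hd i hi.le).2] at lam_eq
    exact_mod_cast show (d (i + 1) : ℚ) + 1 = d i + p (i + 1) by linarith

theorem exists_isTriangularChain (R : Type*) [CommRing R] [Algebra ℂ R] {n : ℕ} {lam : ℕ → ℚ}
    {p : ℕ → ℕ} (hlam1 : (n : ℚ) < lam 1)
    (hlam : ∀ i < n, lam (i + 2) = lam (i + 1) + p (i + 1) - 1) (S : ℕ → PowerSeries R) :
    ∃ (l : ℚ) (d : ℕ → ℕ) (e : ℕ → Xi R {l} n), 0 < l ∧ l ≤ 1 ∧ (∃ m : ℤ, lam 1 = l + m) ∧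
      IsTriangularChain lam S n (fun i => ∏ t ∈ Finset.range i, coeff (p (t + 1)) (S (t + 1)))
        d e := by
  obtain ⟨l, d, l_pos, l_le_one, n_le, d_succ, lam_eq⟩ := exists_natCast_shift hlam1 hlam
  exact ⟨l, d, _, l_pos, l_le_one, ⟨d 0, mod_cast lam_eq 0 n.zero_le⟩,
    isTriangularChain_logChain d_succ n_le lam_eq S⟩

theorem isPrimitiveTheme_thetaP {n : ℕ} {lam : ℕ → ℚ} {p : ℕ → ℕ} (hlam1 : (n : ℚ) < lam 1)
    (hlam : ∀ i < n, lam (i + 2) = lam (i + 1) + p (i + 1) - 1) {S : ℕ → PowerSeries ℂ}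
    (hS : ∀ j, constantCoeff (S j) = 1) (hSp : ∀ i < n, coeff (p (i + 1)) (S (i + 1)) ≠ 0) :
    IsPrimitiveTheme (lam 1) (n + 1) (Cyc ℂ (thetaP lam S n)) (Cyc.aAct (thetaP lam S n)) := by
  obtain ⟨l, d, e, l_pos, l_le_one, lam_eq, he⟩ := exists_isTriangularChain ℂ hlam1 hlam S
  have he_indep := he.linearIndependent fun i hi => mem_nonZeroDivisors_of_ne_zero <|
    Finset.prod_ne_zero_iff.2 fun t ht => hSp t ((Finset.mem_range.1 ht).trans_le hi)
  refine ⟨⟨Cyc.powBasis (isMonicModB_thetaP lam S n)⟩, ⟨Submodule.Quotient.mk 1, ?_⟩, l, n,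
    chainMap lam n hS e, l_pos, l_le_one, lam_eq, chainMap_injective hS he_indep,
    chainMap_aAct hS he.toIsChain⟩
  rw [eq_top_iff, ← (Cyc.powBasis (isMonicModB_thetaP lam S n)).span_eq]
  refine Submodule.span_mono ?_
  rintro _ ⟨i, rfl⟩
  exact ⟨i, (Cyc.powBasis_eq_iterate _ i).symm⟩

end Exponents

section SeriesFamily

variable {E X : Type*} [NormedAddCommGroup E] [NormedSpace ℂ E] [TopologicalSpace X]
  [ChartedSpace E X]

/-- A sequence of invertible series `S_j ∈ 1 + b 𝒪[[b]]` with holomorphic coefficients on a complex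
manifold, given by its restrictions `S V` to the open sets. -/
structure IsSeriesFamily (S : ∀ V : Opens X, ℕ → HolB E V) : Prop where
  constantCoeff : ∀ V j, PowerSeries.constantCoeff (S V j) = 1
  res : ∀ {V W : Opens X} (h : W ≤ V) (j : ℕ), HolB.res h (S V j) = S W j

variable {S : ∀ V : Opens X, ℕ → HolB E V} (hS : IsSeriesFamily S) {lam : ℕ → ℚ} {n : ℕ}
include hS

theorem IsSeriesFamily.map_res_thetaP (lam : ℕ → ℚ) (n : ℕ) {V W : Opens X} (h : W ≤ V) :
    ATilde.map (Hol.res E h : Hol E V →+* Hol E W) (thetaP lam (S V) n) = thetaP lam (S W) n := by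
  rw [map_thetaP _ _ _ (hS.constantCoeff V)]
  exact congrArg (thetaP lam · n) (funext (hS.res h))

theorem IsSeriesFamily.map_eval_constantCoeff {U : Opens X} (x : U) (j : ℕ) :
    PowerSeries.constantCoeff (PowerSeries.map (Hol.eval E x : Hol E U →+* ℂ) (S U j)) = 1 := by
  rw [← coeff_zero_eq_constantCoeff_apply, coeff_map, coeff_zero_eq_constantCoeff_apply,
    hS.constantCoeff, map_one]

omit hS in
/-- The morphisms `Ã_{𝒪(V)} / Ã_{𝒪(V)} (thetaP lam (S V) n) ⟶ Ξ_Λ^{(N)}`, `V ≤ U`, defined by a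
sequence `e` of sections over `U`. -/
noncomputable def familyMap (hS : IsSeriesFamily S) (lam : ℕ → ℚ) (n : ℕ) {Λ : Finset ℚ} {N : ℕ}
    {U : Opens X} (e : ℕ → Xi (Hol E U) Λ N) {V : Opens X} (h : V ≤ U) :
    Cyc (Hol E V) (thetaP lam (S V) n) →ₗ[HolB E V] Xi (Hol E V) Λ N :=
  chainMap lam n (hS.constantCoeff V) fun i => Xi.res h (e i)

theorem familyMap_res {Λ : Finset ℚ} {N : ℕ} {U : Opens X} (e : ℕ → Xi (Hol E U) Λ N)
    {V W : Opens X} (hV : V ≤ U) (h : W ≤ V) (s : Cyc (Hol E V) (thetaP lam (S V) n)) :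
    familyMap hS lam n e (h.trans hV) (Cyc.map _ (hS.map_res_thetaP lam n h) s) =
      Xi.res h (familyMap hS lam n e hV s) := by
  simp only [familyMap, ← Xi.res_res hV h]
  exact chainMap_map _ (hS.constantCoeff V) (hS.constantCoeff W) (hS.res h) _ _ s

namespace IsTriangularChain

variable {U : Opens X} {l : ℚ} {c : ℕ → Hol E U} {d : ℕ → ℕ} {e : ℕ → Xi (Hol E U) {l} n}

theorem res (he : IsTriangularChain lam (S U) n c d e) {V : Opens X} (h : V ≤ U) :
    IsTriangularChain lam (S V) n (fun i => Hol.res E h (c i)) d fun i => Xi.res h (e i) := by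
  have := he.map (Hol.res E h)
  rwa [show (fun j => PowerSeries.map _ (S U j)) = S V from funext (hS.res h)] at this

variable (he : IsTriangularChain lam (S U) n c d e) (hc : ∀ i ≤ n, ∀ x, c i x ≠ 0)
include he hc

theorem linearIndependent_res {V : Opens X} (h : V ≤ U) :
    LinearIndependent (HolB E V) fun i : Fin (n + 1) => Xi.res h (e i) :=
  (he.res hS h).linearIndependent fun i hi =>
    Hol.mem_nonZeroDivisors fun x => hc i hi ⟨x, h x.2⟩

theorem range_familyMap {V : Opens X} (h : V ≤ U) :
    LinearMap.range (familyMap hS lam n e h) = genSheaf (e n) V h :=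
  range_eq_genSheaf (hS.map_res_thetaP lam n) (fun V => isMonicModB_thetaP lam (S V) n)
    (familyMap hS lam n e)
    (fun h => chainMap_injective (hS.constantCoeff _) (he.linearIndependent_res hS hc h))
    (familyMap_res hS e)
    (fun h => ((he.res hS h).span_iterate (hS.constantCoeff _)).symm) h

theorem isThematic : IsThematic (n + 1) (e n) where
  linearIndependent V h := (he.res hS h).linearIndependent_iterate (hS.constantCoeff V)
    (he.linearIndependent_res hS hc h)
  span_eq V h := ((he.res hS h).span_iterate_fin (hS.constantCoeff V)).trans
    (he.range_familyMap hS hc h)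
  fibre x := (he.map (Hol.eval E x)).linearIndependent_iterate (hS.map_eval_constantCoeff x)
    ((he.map (Hol.eval E x)).linearIndependent fun i hi =>
      mem_nonZeroDivisors_of_ne_zero (hc i hi x))

end IsTriangularChain

end SeriesFamily

theorem isHolomorphicFamilyOfThemes_thetaFamily {E X : Type} [NormedAddCommGroup E]
    [NormedSpace ℂ E] [TopologicalSpace X] [ChartedSpace E X]
    {S : ∀ V : Opens X, ℕ → HolB E V} (hS : IsSeriesFamily S) {n : ℕ} {lam : ℕ → ℚ} {p : ℕ → ℕ}
    (hlam1 : (n : ℚ) < lam 1) (hlam : ∀ i < n, lam (i + 2) = lam (i + 1) + p (i + 1) - 1)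
    (hSp : ∀ i < n, ∀ x, coeff (p (i + 1)) (S ⊤ (i + 1)) x ≠ 0) :
    IsHolomorphicFamilyOfThemes (n + 1)
      (cyclicFamily (fun V => thetaP lam (S V) n) (hS.map_res_thetaP lam n)) := by
  obtain ⟨l, d, e, l_pos, l_le_one, -, he⟩ :=
    exists_isTriangularChain (Hol E (⊤ : Opens X)) hlam1 hlam (S ⊤)
  have prod_ne_zero (i : ℕ) (hi : i ≤ n) (x : (⊤ : Opens X)) :
      (∏ t ∈ Finset.range i, coeff (p (t + 1)) (S ⊤ (t + 1))) x ≠ 0 := by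
    change Hol.eval E x _ ≠ 0
    rw [map_prod]
    exact Finset.prod_ne_zero_iff.2 fun t ht => hSp t ((Finset.mem_range.1 ht).trans_le hi) x
  exact fun x => ⟨⊤, {l}, e n, fun V h => familyMap hS lam n e h, trivial,
    fun q hq => Finset.mem_singleton.1 hq ▸ ⟨l_pos, l_le_one⟩, he.isThematic hS prod_ne_zero,
    fun V h => ⟨chainMap_injective (hS.constantCoeff V)
      (he.linearIndependent_res hS prod_ne_zero h), he.range_familyMap hS prod_ne_zero h⟩,
    fun V h => chainMap_aAct (hS.constantCoeff V) (he.res hS h).toIsChain,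
    fun V W => familyMap_res hS e⟩

/-! ### The canonical family -/

section ParameterSpace

variable {k : ℕ} {p : ℕ → ℕ}

theorem mem_expV {j : ℕ} (hj : j ∈ Finset.Icc 1 (k - 1)) : p j ∈ expV k p j := by
  rw [Finset.mem_Icc] at hj
  have p_le_sum : p j ≤ ∑ i ∈ Finset.Icc j (k - 1), p i :=
    Finset.single_le_sum (fun _ _ => Nat.zero_le _) (Finset.mem_Icc.2 ⟨le_rfl, hj.2⟩)
  unfold expV
  split_ifs with hsum
  · exact Finset.mem_range.2 (p_le_sum.trans_lt hsum)
  · rcases lt_or_ge (p j) (k - j) with hp | hp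
    · exact Finset.mem_insert_of_mem (Finset.mem_range.2 hp)
    · have h_eq_zero : sInf {h | k - j ≤ ∑ i ∈ Finset.Icc j (j + h), p i} = 0 :=
        Nat.sInf_eq_zero.2 (Or.inl (by simpa using hp))
      rw [h_eq_zero, add_zero, Finset.Icc_self, Finset.sum_singleton]
      exact Finset.mem_insert_self _ _

theorem coeff_zero_seriesOf (s : CoordIdx k p → ℂ) (j : ℕ) : coeff 0 (seriesOf s j) = 1 := by
  rw [seriesOf, coeff_mk, if_pos rfl]

theorem coeff_seriesOf_coordIdx (s : CoordIdx k p → ℂ) (i : CoordIdx k p) :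
    coeff i.1.2 (seriesOf s i.1.1) = s i := by
  have exponent_ne_zero : i.1.2 ≠ 0 := (Finset.mem_erase.1 (Finset.mem_sigma.1 i.2).2).1
  rw [seriesOf, coeff_mk, if_neg exponent_ne_zero]
  exact dif_pos i.2

theorem mem_paramOpens_iff (s : CoordIdx k p → ℂ) :
    s ∈ paramOpens k p ↔ ∀ i : CoordIdx k p, i.1.2 = p i.1.1 → s i ≠ 0 := by
  change (∀ j ∈ Finset.Icc 1 (k - 1), coeff (p j) (seriesOf s j) ≠ 0) ↔ _
  refine ⟨fun h i hi => ?_, fun h j hj => ?_⟩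
  · rw [← coeff_seriesOf_coordIdx s i, hi]
    exact h _ (Finset.mem_sigma.1 i.2).1
  · rcases eq_or_ne (p j) 0 with hp | hp
    · rw [hp, coeff_zero_seriesOf]
      exact one_ne_zero
    · let i : CoordIdx k p :=
        ⟨⟨j, p j⟩, Finset.mem_sigma.2 ⟨hj, Finset.mem_erase.2 ⟨hp, mem_expV hj⟩⟩⟩
      exact (coeff_seriesOf_coordIdx s i).symm ▸ h i rfl

variable (k p) in
theorem exists_equiv_mem_paramOpens_iff :
    ∃ (m n : ℕ) (r : Fin m ⊕ Fin n ≃ CoordIdx k p), ∀ s : CoordIdx k p → ℂ,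
      s ∈ paramOpens k p ↔ ∀ i : Fin n, s (r (Sum.inr i)) ≠ 0 := by
  classical
  let free := Fintype.equivFin {i : CoordIdx k p // ¬ i.1.2 = p i.1.1}
  let nonzero := Fintype.equivFin {i : CoordIdx k p // i.1.2 = p i.1.1}
  refine ⟨_, _, (Equiv.sumCongr free.symm nonzero.symm).trans ((Equiv.sumComm _ _).trans
    (Equiv.sumCompl fun i : CoordIdx k p => i.1.2 = p i.1.1)), fun s => ?_⟩
  rw [mem_paramOpens_iff, nonzero.symm.forall_congr_left, Subtype.forall]
  simp

end ParameterSpace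

section CanonicalFamily

variable {k : ℕ} {p : ℕ → ℕ} {lam1 : ℚ}

theorem isMonicModB_canonPOn (V : Opens (paramOpens k p)) :
    (canonPOn lam1 V).IsMonicModB (k - 1 + 1) :=
  isMonicModB_thetaP _ _ _

theorem map_eval_canonPOn {V : Opens (paramOpens k p)} (x : V) :
    ATilde.map (Hol.eval (CoordIdx k p → ℂ) x : Hol (CoordIdx k p → ℂ) V →+* ℂ)
      (canonPOn lam1 V) = canonP lam1 (x : paramOpens k p) := by
  have map_eval_tautSeries (j : ℕ) : PowerSeries.map (Hol.eval (CoordIdx k p → ℂ) x :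
      Hol (CoordIdx k p → ℂ) V →+* ℂ) (tautSeries V j) = seriesOf x.1.1 j := by
    ext n
    rw [coeff_map, tautSeries, coeff_mk]
    rfl
  rw [canonPOn, map_thetaP _ _ _ (constantCoeff_tautSeries V), canonP]
  exact congrArg (thetaP _ · _) (funext map_eval_tautSeries)

variable (k p) in
theorem isSeriesFamily_tautSeries :
    IsSeriesFamily (tautSeries (k := k) (p := p)) where
  constantCoeff := constantCoeff_tautSeries
  res h j := by
    ext n : 1
    rw [HolB.coeff_res, tautSeries, tautSeries, coeff_mk, coeff_mk]
    rfl

variable (k p lam1) in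
theorem isABSheaf_canonicalFamily : IsABSheaf (canonicalFamily k lam1 p) :=
  isABSheaf_cyclicFamily (map_res_canonPOn lam1) isMonicModB_canonPOn

variable (lam1) in
theorem isFibre_canonicalFamily (σ : paramOpens k p) :
    IsFibre (canonicalFamily k lam1 p) σ (canonE lam1 σ) (Cyc.aAct (canonP lam1 σ)) :=
  isFibre_cyclicFamily (map_res_canonPOn lam1) isMonicModB_canonPOn σ
    fun V hx => map_eval_canonPOn (⟨σ, hx⟩ : V)

theorem coeff_seriesOf_ne_zero {n : ℕ} (σ : paramOpens (n + 1) p) {i : ℕ} (hi : i < n) :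
    coeff (p (i + 1)) (seriesOf (σ : CoordIdx (n + 1) p → ℂ) (i + 1)) ≠ 0 :=
  σ.2 (i + 1) (Finset.mem_Icc.2 ⟨by omega, hi⟩)

theorem isPrimitiveTheme_canonE (hk : 1 ≤ k) (hlam : (k : ℚ) - 1 < lam1) (σ : paramOpens k p) :
    IsPrimitiveTheme lam1 k (canonE lam1 σ) (Cyc.aAct (canonP lam1 σ)) := by
  obtain ⟨n, rfl⟩ := Nat.exists_eq_add_of_le' hk
  refine isPrimitiveTheme_thetaP (lam := lamSeq lam1 p) (p := p) ?_ (fun _ _ => rfl) (fun j => ?_)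
    fun i => coeff_seriesOf_ne_zero σ
  · change (n : ℚ) < lam1
    simpa using hlam
  · rw [← coeff_zero_eq_constantCoeff_apply, coeff_zero_seriesOf]

theorem isHolomorphicFamilyOfThemes_canonicalFamily (hk : 1 ≤ k) (hlam : (k : ℚ) - 1 < lam1) :
    IsHolomorphicFamilyOfThemes k (canonicalFamily k lam1 p) := by
  obtain ⟨n, rfl⟩ := Nat.exists_eq_add_of_le' hk
  refine isHolomorphicFamilyOfThemes_thetaFamily (isSeriesFamily_tautSeries (n + 1) p)
    (lam := lamSeq lam1 p) (p := p) ?_ (fun _ _ => rfl) fun i hi x => ?_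
  · change (n : ℚ) < lam1
    simpa using hlam
  · rw [tautSeries, coeff_mk]
    exact coeff_seriesOf_ne_zero x.1 hi

end CanonicalFamily

end ABTheme

theorem theorem2p1p2 (k : ℕ) (hk : 1 ≤ k) (lam1 : ℚ) (hlam : (k : ℚ) - 1 < lam1) (p : ℕ → ℕ) :
    (∃ (m n : ℕ) (r : Fin m ⊕ Fin n ≃ ABTheme.CoordIdx k p),
      ∀ s : ABTheme.CoordIdx k p → ℂ,
        s ∈ ABTheme.paramOpens k p ↔ ∀ i : Fin n, s (r (Sum.inr i)) ≠ 0) ∧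
    ABTheme.IsABSheaf (ABTheme.canonicalFamily k lam1 p) ∧
    (∀ σ : ABTheme.paramOpens k p,
      ABTheme.IsPrimitiveTheme lam1 k (ABTheme.canonE lam1 σ)
        (ABTheme.Cyc.aAct (ABTheme.canonP lam1 σ)) ∧
      ABTheme.IsFibre (ABTheme.canonicalFamily k lam1 p) σ (ABTheme.canonE lam1 σ)
        (ABTheme.Cyc.aAct (ABTheme.canonP lam1 σ))) ∧
    ABTheme.IsHolomorphicFamilyOfThemes k (ABTheme.canonicalFamily k lam1 p) :=
  ⟨ABTheme.exists_equiv_mem_paramOpens_iff k p, ABTheme.isABSheaf_canonicalFamily k p lam1,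
    fun σ => ⟨ABTheme.isPrimitiveTheme_canonE hk hlam σ,
      ABTheme.isFibre_canonicalFamily lam1 σ⟩,
    ABTheme.isHolomorphicFamilyOfThemes_canonicalFamily hk hlam⟩
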